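/- All logarithms are to base 2. Let $\mathcal X$ be a finite set and $\mathcal Y$ a measurable space. A general source $\boldsymbol X=\{\mu_{X^n}\}_{n\ge1}$ is a sequence of probability distributions $\mu_{X^n}$ on $\mathcal X^n$, and a general channel $\boldsymbol W=\{\mu_{Y^n|X^n}\}_{n\ge1}$ is a sequence of conditional probability distributions on $\mathcal Y^n$ given $\boldsymbol x\in\mathcal X^n$. Given both, $(X^n,Y^n)$ has law $\mu_{X^n}(\boldsymbol x)\,\mu_{Y^n|X^n}(d\boldsymbol y|\boldsymbol x)$, and $\mu_{X^n|Y^n}$ is its conditional probability. Let $\underline H(\boldsymbol X)$ be the limit inferior in probability of $\frac1n\log\frac1{\mu_{X^n}(X^n)}$, that is, $\sup\{\theta:\lim_n P(\frac1n\log\frac1{\mu_{X^n}(X^n)}<\theta)=0\}$, and let $\overline H(\boldsymbol X|\boldsymbol Y)$ be the limit superior in probability of $\frac1n\log\frac1{\mu_{X^n|Y^n}(X^n|Y^n)}$, that is, $\inf\{\theta:\lim_n P(\frac1n\log\frac1{\mu_{X^n|Y^n}(X^n|Y^n)}>\theta)=0\}$. An ensemble on $\mathcal X^n$ is a finite set $\mathcal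 A_n$ of functions on $\mathcal X^n$ with a probability distribution $p_{\mathsf A,n}$ on it; $\mathrm{Im}\mathcal A_n=\bigcup_{A\in\mathcal A_n}A(\mathcal X^n)$. For reals $\alpha(n),\beta(n)$ consider the condition that, for all sufficiently large $n$ and all $\boldsymbol x\in\mathcal X^n$, $$\sum_{\boldsymbol x'\ne\boldsymbol x:\ p_{\mathsf A,n}(\{A:A\boldsymbol x=A\boldsymbol x'\})>\alpha(n)/|\mathrm{Im}\mathcal A_n|}p_{\mathsf A,n}(\{A:A\boldsymbol x=A\boldsymbol x'\})\le\beta(n).\qquad(*)$$ A sequence of ensembles has the $(\boldsymbol\alpha,\boldsymbol\beta)$-collision-resistance property if $(*)$ holds, $\limsup_n\frac1n\log\alpha(n)=0$ and $\limsup_n\beta(n)=0$; it has the $(\boldsymbol\alpha,\boldsymbol\beta)$-balanced-coloring property if $(*)$ holds, $\limsup_n\alpha(n)=1$ and $\limsup_n\frac1n\log(\beta(n)+1)=0$. For functions $A,B$ on $\mathcal X^n$ and a value $\boldsymbol c$, let $\boldsymbol x_A(\boldsymbol c|\boldsymbol y)$ be a maximizer of $\mu_{X^n|Y^n}(\boldsymbol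 x|\boldsymbol y)$ over the $\boldsymbol x$ with $A\boldsymbol x=\boldsymbol c$ (ties broken arbitrarily). The channel code given by $(A,B,\boldsymbol c)$ has message set $\mathrm{Im}\mathcal B_n$, with uniformly distributed messages. Its stochastic encoder sends, for the message $\boldsymbol m$, a random $\boldsymbol x$ distributed as $\mu_{X^n}$ conditioned on $A\boldsymbol x=\boldsymbol c$ and $B\boldsymbol x=\boldsymbol m$, and declares an error if this event has probability $0$. Its decoder is $\boldsymbol y\mapsto B\boldsymbol x_A(\boldsymbol c|\boldsymbol y)$. Its error probability $\mathrm{Error}(A,B,\boldsymbol c)$ is the probability that the encoder declares an error or the decoded message differs from $\boldsymbol m$. Let $\boldsymbol{\mathcal P}=\{\mathcal P_n\}$ be an input constraint, a sequence of sets of distributions on $\mathcal X^n$. A rate $R$ is achievable if for every $\delta>0$ and all large $n$ there are a finite message set $\mathcal M_n$ with $\frac1n\log|\mathcal M_n|\ge R$, an encoder $\varphi_n:\mathcal M_n\to\mathcal X^n$ whose output law under uniform messages belongs to $\mathcal P_n$, and a decoder $\psi_n:\mathcal Y^n\to\mathcal M_n$ with error probability at most $\delta$; the capacity $C_{\boldsymbol{\mathcal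 P}}(\boldsymbol W)$ is the supremum of the achievable rates. 1. Let $(\boldsymbol{\mathcal A},\boldsymbol p_{\mathsf A})$ have a collision-resistance property and $(\boldsymbol{\mathcal B},\boldsymbol p_{\mathsf B})$ a balanced-coloring property, with $\frac1n\log|\mathrm{Im}\mathcal A_n|\to r$ and $\frac1n\log|\mathrm{Im}\mathcal B_n|\to R$ (in particular, with equality for all $n$), where $r>\overline H(\boldsymbol X|\boldsymbol Y)$ and $r+R<\underline H(\boldsymbol X)$. Then for every $\delta>0$ and all sufficiently large $n$ there are $A\in\mathcal A_n$, $B\in\mathcal B_n$ and $\boldsymbol c\in\mathrm{Im}\mathcal A_n$ with $\mathrm{Error}(A,B,\boldsymbol c)<\delta$. 2. The capacity is achieved by this code. If all $\mathcal P_n$ are non-empty, then $\sup[\underline H(\boldsymbol X)-\overline H(\boldsymbol X|\boldsymbol Y)]$ over the sources with $\mu_{X^n}\in\mathcal P_n$ for all $n$ is attained; without input constraint it equals the capacity. If $\boldsymbol X$ attains it and its value is positive, then for every $\varepsilon>0$ there are ensembles and numbers $r,R$ satisfying all the assumptions of part 1 with $R>\underline H(\boldsymbol X)-\overline H(\boldsymbol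 X|\boldsymbol Y)-\varepsilon$, and for every $\delta>0$ and all sufficiently large $n$ there are $A\in\mathcal A_n$, $B\in\mathcal B_n$, $\boldsymbol c\in\mathrm{Im}\mathcal A_n$ with $\frac1n\log|\mathrm{Im}\mathcal B_n|>C_{\boldsymbol{\mathcal P}}(\boldsymbol W)-\varepsilon$ and $\mathrm{Error}(A,B,\boldsymbol c)<\delta$. -/

import Mathlib

open Filter Topology MeasureTheory

noncomputable section

namespace ChannelCRNG

/-! All logarithms are to base 2. A block of length `n` over an alphabet `S` is an element of
`Fin n → S`; the value `n = 0` never matters, since every claim is about large `n`. -/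

/-- A general source: a sequence of probability distributions on `𝒳 ^ n`, with no consistency or
stationarity condition. -/
abbrev GeneralSource (𝒳 : Type*) := (n : ℕ) → PMF (Fin n → 𝒳)

/-- A general channel: for every `n` and every input block, a probability distribution on the
output blocks. The output alphabet is an arbitrary measurable space. -/
abbrev GeneralChannel (𝒳 𝒴 : Type*) [MeasurableSpace 𝒴] :=
  (n : ℕ) → (Fin n → 𝒳) → ProbabilityMeasure (Fin n → 𝒴)

/-- A channel input constraint: for every `n`, a set of distributions on `𝒳 ^ n`. -/
abbrev InputConstraint (𝒳 : Type*) := (n : ℕ) → Set (PMF (Fin n → 𝒳))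

/-- The absence of a channel input constraint. -/
def noConstraint (𝒳 : Type*) : InputConstraint 𝒳 := fun _ => Set.univ

section Entropy

variable {𝒳 𝒴 : Type*} [Fintype 𝒳] [MeasurableSpace 𝒴]

/-- The law of the channel output `Y ^ n` when the input is `X ^ n`. -/
def outputLaw (X : GeneralSource 𝒳) (W : GeneralChannel 𝒳 𝒴) (n : ℕ) : Measure (Fin n → 𝒴) :=
  ∑ x : Fin n → 𝒳, X n x • (W n x : Measure (Fin n → 𝒴))

/-- The conditional probability of the input block `x` given the output block `y`, that is,
`μ(y|x) μ(x) / ∑ x', μ(y|x') μ(x')`, written as the density of the (joint) measure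
`μ(x) μ(dy|x)` with respect to the output law. For a discrete output this is the elementary
quotient, and for densities with respect to any reference measure it is the quotient of the
densities, almost everywhere for the output law. -/
def posterior (X : GeneralSource 𝒳) (W : GeneralChannel 𝒳 𝒴) (n : ℕ)
    (x : Fin n → 𝒳) (y : Fin n → 𝒴) : ℝ :=
  ((X n x • (W n x : Measure (Fin n → 𝒴))).rnDeriv (outputLaw X W n) y).toReal

open Classical in
/-- The spectral inf-entropy rate: the limit inferior in probability of `(1/n) log (1/μ(X ^ n))`.
(For a finite alphabet the set contains `0` and is bounded above by `log |𝒳|`.) -/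
def infEntropyRate (X : GeneralSource 𝒳) : ℝ :=
  sSup {θ : ℝ | Tendsto (fun n : ℕ =>
    ∑ x : Fin n → 𝒳 with 1 / (n : ℝ) * Real.logb 2 (1 / (X n x).toReal) < θ, (X n x).toReal)
    atTop (𝓝 0)}

/-- The conditional spectral sup-entropy rate: the limit superior in probability of
`(1/n) log (1/μ(X ^ n|Y ^ n))`, where `Y ^ n` is the channel output for the input `X ^ n`.
(For a finite input alphabet the set contains every `θ > log |𝒳|` and is bounded below by `0`.) -/
def condSupEntropyRate (X : GeneralSource 𝒳) (W : GeneralChannel 𝒳 𝒴) : ℝ :=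
  sInf {θ : ℝ | Tendsto (fun n : ℕ =>
    ∑ x : Fin n → 𝒳, (X n x).toReal * (W n x : Measure (Fin n → 𝒴)).real
      {y | θ < 1 / (n : ℝ) * Real.logb 2 (1 / posterior X W n x y)})
    atTop (𝓝 0)}

/-- The quantity maximized in the capacity formula: the spectral inf-entropy rate of the input
minus the conditional spectral sup-entropy rate of the input given the output. -/
def entropyGap (X : GeneralSource 𝒳) (W : GeneralChannel 𝒳 𝒴) : ℝ :=
  infEntropyRate X - condSupEntropyRate X W

end Entropy

section Capacity

variable {𝒳 𝒴 : Type*} [MeasurableSpace 𝒴]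

/-- `R` is an achievable rate of the channel `W` under the input constraint `P`: for every
`δ > 0` and all large `n` there are a message set of size `M` with `(1/n) log M ≥ R`, an encoder
whose output law under uniform messages belongs to `P n`, and a decoder, with decoding error
probability at most `δ`. -/
def IsAchievable (W : GeneralChannel 𝒳 𝒴) (P : InputConstraint 𝒳) (R : ℝ) : Prop :=
  ∀ δ : ℝ, 0 < δ → ∀ᶠ n : ℕ in atTop,
    ∃ (M : ℕ) (_ : NeZero M) (φ : Fin M → (Fin n → 𝒳)) (ψ : (Fin n → 𝒴) → Fin M),
      Measurable ψ ∧
      R ≤ 1 / (n : ℝ) * Real.logb 2 M ∧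
      (PMF.uniformOfFintype (Fin M)).map φ ∈ P n ∧
      ∑ m : Fin M, 1 / (M : ℝ) * (W n (φ m) : Measure (Fin n → 𝒴)).real {y | ψ y ≠ m} ≤ δ

/-- The (operational) channel capacity: the supremum of the achievable rates. -/
def channelCapacity (W : GeneralChannel 𝒳 𝒴) (P : InputConstraint 𝒳) : EReal :=
  sSup ((fun R : ℝ => (R : EReal)) '' {R : ℝ | IsAchievable W P R})

end Capacity

/-- An ensemble: a finite set of functions `V → L` with a probability distribution on it.
(When `V` is finite, a set of functions with finitely many values altogether is finite.) -/
structure FunctionEnsemble (V L : Type*) where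
  /-- the set of functions -/
  carrier : Finset (V → L)
  /-- the probability of each function of the set -/
  prob : (V → L) → ℝ
  prob_nonneg : ∀ A ∈ carrier, 0 ≤ prob A
  sum_prob : ∑ A ∈ carrier, prob A = 1

namespace FunctionEnsemble

variable {V L : Type*} [Fintype V]

open Classical in
/-- The image of the ensemble, that is, the union of the images of all its functions. -/
def im (𝒜 : FunctionEnsemble V L) : Finset L :=
  𝒜.carrier.biUnion fun A => Finset.univ.image A

open Classical in
/-- The probability that a random function of the ensemble takes the same value at `x` and `x'`. -/
def collisionProb (𝒜 : FunctionEnsemble V L) (x x' : V) : ℝ :=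
  ∑ A ∈ 𝒜.carrier with A x = A x', 𝒜.prob A

open Classical in
/-- The inequality shared by the balanced-coloring and the collision-resistance property. -/
def HashBound (𝒜 : FunctionEnsemble V L) (α β : ℝ) : Prop :=
  ∀ x : V, ∑ x' : V with x' ≠ x ∧ α / (𝒜.im.card : ℝ) < 𝒜.collisionProb x x',
    𝒜.collisionProb x x' ≤ β

end FunctionEnsemble

/-- The rate `(1/n) log |Im 𝒜|` of an ensemble of functions on blocks of length `n`. -/
def ensembleRate {𝒳 L : Type*} [Fintype 𝒳] (n : ℕ) (𝒜 : FunctionEnsemble (Fin n → 𝒳) L) : ℝ :=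
  1 / (n : ℝ) * Real.logb 2 (𝒜.im.card : ℝ)

/-- `(1/n) log t` as an extended real number, with `log t = -∞` for `t ≤ 0`. -/
def normalizedLog (n : ℕ) (t : ℝ) : EReal :=
  if 0 < t then ((1 / (n : ℝ) * Real.logb 2 t : ℝ) : EReal) else ⊥

section Properties

variable {𝒳 : Type*} [Fintype 𝒳] {L : ℕ → Type*}

/-- The `(α, β)`-collision-resistance property of a sequence of ensembles. -/
structure CollisionResistance (𝒜 : (n : ℕ) → FunctionEnsemble (Fin n → 𝒳) (L n))
    (α β : ℕ → ℝ) : Prop where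
  limsup_alpha : limsup (fun n => normalizedLog n (α n)) atTop = 0
  limsup_beta : limsup (fun n => (β n : EReal)) atTop = 0
  hash : ∀ᶠ n in atTop, (𝒜 n).HashBound (α n) (β n)

/-- The `(α, β)`-balanced-coloring property of a sequence of ensembles. -/
structure BalancedColoring (ℬ : (n : ℕ) → FunctionEnsemble (Fin n → 𝒳) (L n))
    (α β : ℕ → ℝ) : Prop where
  limsup_alpha : limsup (fun n => (α n : EReal)) atTop = 1
  limsup_beta : limsup (fun n => normalizedLog n (β n + 1)) atTop = 0
  hash : ∀ᶠ n in atTop, (ℬ n).HashBound (α n) (β n)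

end Properties

section Code

/-- `dec c y` is a decoder `x_A(c|y)` for the source encoder `A` with decoder side information `y`:
it returns a maximizer of the conditional probability of `x` given `y` (equivalently, of the joint
probability) over the `x` with `A x = c`. Ties are broken arbitrarily. The maximization is asked
for almost every `y`, so that it does not depend on the version of the conditional probability. -/
def IsMAPDecoder {𝒳 𝒴 K : Type*} [Fintype 𝒳] [MeasurableSpace 𝒴]
    (X : GeneralSource 𝒳) (W : GeneralChannel 𝒳 𝒴) (n : ℕ) (A : (Fin n → 𝒳) → K)
    (dec : K → (Fin n → 𝒴) → (Fin n → 𝒳)) : Prop :=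
  (∀ c ∈ Set.range A, ∀ y, A (dec c y) = c) ∧
  ∀ c ∈ Set.range A, ∀ᵐ y ∂(outputLaw X W n), ∀ x, A x = c →
    posterior X W n x y ≤ posterior X W n (dec c y) y

variable {V K L : Type*} [Fintype V]

open Classical in
/-- The set of `x` with `A x = c` and `B x = m`. -/
def constrainedSet (A : V → K) (B : V → L) (c : K) (m : L) : Finset V :=
  {x | A x = c ∧ B x = m}

/-- The probability of the set of `x` with `A x = c` and `B x = m`. -/
def constrainedMass (μ : PMF V) (A : V → K) (B : V → L) (c : K) (m : L) : ℝ :=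
  ∑ x ∈ constrainedSet A B c m, (μ x).toReal

open Classical in
/-- The constrained-random-number generator: the distribution `μ` conditioned on `A x = c` and
`B x = m`. It is the law of the channel input that the stochastic encoder sends for the message
`m`; the encoder declares an error when the condition has probability `0`. -/
def encoderLaw (μ : PMF V) (A : V → K) (B : V → L) (c : K) (m : L) (x : V) : ℝ :=
  if x ∈ constrainedSet A B c m then (μ x).toReal / constrainedMass μ A B c m else 0

/-- The channel decoder: `y ↦ B (x_A(c|y))`. -/
def channelDecoder {O : Type*} (B : V → L) (dec : K → O → V) (c : K) (y : O) : L :=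
  B (dec c y)

open Classical in
/-- The error probability of the channel code given by `A`, `B`, `c` and the decoder `x_A`, for a
message uniformly distributed on the finite set `msgs`: either the encoder fails, or the decoded
message differs from the message sent. -/
def codeError {O : Type*} [MeasurableSpace O] (μ : PMF V) (W : V → ProbabilityMeasure O)
    (msgs : Finset L) (A : V → K) (B : V → L) (c : K) (dec : K → O → V) : ℝ :=
  ∑ m ∈ msgs with constrainedMass μ A B c m = 0, 1 / (msgs.card : ℝ) +
  ∑ m ∈ msgs with 0 < constrainedMass μ A B c m, ∑ x : V,
    1 / (msgs.card : ℝ) * encoderLaw μ A B c m x *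
      (W x : Measure O).real {y | channelDecoder B dec c y ≠ m}

end Code

end ChannelCRNG

end

/-! Reliability is a one-shot bound, averaged over `A` and `B`, with each `c` weighted by the
probability that `A x = c`. If `x` followed the source and the message were `B x`, the only possible
error would be that of maximum a posteriori decoding with the hash value `A x` as side information.
The actual message is uniform instead of distributed as `B x` given `A x = c`; this costs at most
the total amount by which the classes of `B` inside the fiber of `A` fall short of equal masses
(`mass_mul_codeError_le`).

Decoding: at most `1 / t` inputs have posterior at least `t`, and collision resistance at a rate
above the conditional entropy rate separates the true input from them (`sum_prob_mul_confusion_le`).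
Deficiency: a second-moment bound (`sum_prob_mul_sum_max_le`) makes it small when no input carries
more than a fraction `s`, slightly below `2 ^ (-n R)`, of its fiber. Exceptions are rare because `r
+ R` is below the entropy rate (`sum_sum_fiberWeight_gt_le`).

Attainment: a general source links no two block lengths, so good distributions for different `n` can
be spliced (`exists_diagonal`) and limits of rate pairs are dominated by actual sources. Converse:
in a reliable code few messages share a codeword, so the channel input has entropy rate at least
`R`, and it is recoverable from the output, so its conditional entropy rate vanishes. Direct part:
uniform random binning has both hash properties, and choosing the best input for every message makes
the encoder deterministic. This last choice does not control the input law, hence equality with the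
capacity only without constraint. -/

namespace ChannelCRNG

/-! ### Collision and balancing estimates for hash ensembles -/

namespace FunctionEnsemble

variable {V L : Type*}

lemma collisionProb_nonneg (𝒜 : FunctionEnsemble V L) (x x' : V) : 0 ≤ 𝒜.collisionProb x x' := by
  classical
  exact Finset.sum_nonneg fun A hA => 𝒜.prob_nonneg A (Finset.mem_filter.1 hA).1

lemma collisionProb_self (𝒜 : FunctionEnsemble V L) (x : V) : 𝒜.collisionProb x x = 1 := by
  classical
  simp [collisionProb, 𝒜.sum_prob]

lemma carrier_nonempty (𝒜 : FunctionEnsemble V L) : 𝒜.carrier.Nonempty := by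
  by_contra h
  have := 𝒜.sum_prob
  simp [Finset.not_nonempty_iff_eq_empty.1 h] at this

variable [Fintype V]

lemma apply_mem_im (𝒜 : FunctionEnsemble V L) {A : V → L} (hA : A ∈ 𝒜.carrier) (x : V) :
    A x ∈ 𝒜.im := by
  classical
  exact Finset.mem_biUnion.2 ⟨A, hA, Finset.mem_image_of_mem _ (Finset.mem_univ _)⟩

lemma im_card_pos [Nonempty V] (𝒜 : FunctionEnsemble V L) : 0 < (𝒜.im.card : ℝ) := by
  obtain ⟨A, hA⟩ := 𝒜.carrier_nonempty
  exact_mod_cast Finset.card_pos.2 ⟨_, 𝒜.apply_mem_im hA (Classical.arbitrary V)⟩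

lemma HashBound.mono {𝒜 : FunctionEnsemble V L} {α α' β β' : ℝ} (h : 𝒜.HashBound α β)
    (hα : α ≤ α') (hβ : β ≤ β') : 𝒜.HashBound α' β' := by
  classical
  intro x
  refine le_trans (Finset.sum_le_sum_of_subset_of_nonneg ?_ ?_) ((h x).trans hβ)
  · intro x' hx'
    simp only [Finset.mem_filter, Finset.mem_univ, true_and] at hx' ⊢
    exact ⟨hx'.1, lt_of_le_of_lt (by gcongr) hx'.2⟩
  · exact fun _ _ _ => 𝒜.collisionProb_nonneg _ _

open Classical in
-- Pairs above the threshold `α / |Im|` have total collision probability at most `β` and weight at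
-- most `M` each; every other pair collides with probability at most the threshold.
lemma sum_mul_collisionProb_le {𝒜 : FunctionEnsemble V L} {α β : ℝ} (h : 𝒜.HashBound α β)
    (hα : 0 ≤ α) (x : V) {f : V → ℝ} {M : ℝ} (hf : ∀ x', 0 ≤ f x') (hM : ∀ x', f x' ≤ M) :
    ∑ x' with x' ≠ x, f x' * 𝒜.collisionProb x x' ≤
      M * β + α / (𝒜.im.card : ℝ) * ∑ x', f x' := by
  have hM0 : 0 ≤ M := (hf x).trans (hM x)
  have hα' : 0 ≤ α / (𝒜.im.card : ℝ) := by positivity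
  calc ∑ x' with x' ≠ x, f x' * 𝒜.collisionProb x x'
      ≤ ∑ x' with x' ≠ x, ((if α / (𝒜.im.card : ℝ) < 𝒜.collisionProb x x' then
          M * 𝒜.collisionProb x x' else 0) + α / (𝒜.im.card : ℝ) * f x') := by
        refine Finset.sum_le_sum fun x' _ => ?_
        have h0 := 𝒜.collisionProb_nonneg x x'
        split_ifs with hc
        · have := mul_le_mul_of_nonneg_right (hM x') h0
          have := mul_nonneg hα' (hf x')
          linarith
        · have := mul_le_mul_of_nonneg_left (not_lt.1 hc) (hf x')
          linarith
    _ ≤ M * β + α / (𝒜.im.card : ℝ) * ∑ x', f x' := by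
        rw [Finset.sum_add_distrib, ← Finset.mul_sum]
        refine add_le_add ?_ (mul_le_mul_of_nonneg_left
          (Finset.sum_le_sum_of_subset_of_nonneg (Finset.subset_univ _) fun _ _ _ => hf _) hα')
        rw [← Finset.sum_filter, Finset.filter_filter, ← Finset.mul_sum]
        exact mul_le_mul_of_nonneg_left (h x) hM0

open Classical in
/-- The probability that a random function of the ensemble maps `x` to the same value as another
element of a given set. -/
lemma prob_collision_le {𝒜 : FunctionEnsemble V L} {α β : ℝ} (h : 𝒜.HashBound α β)
    (hα : 0 ≤ α) (x : V) (T : Finset V) :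
    ∑ A ∈ 𝒜.carrier with ∃ x' ∈ T, x' ≠ x ∧ A x' = A x, 𝒜.prob A ≤
      β + α / (𝒜.im.card : ℝ) * (T.card : ℝ) := by
  -- The indicator of `T` as weight turns the general estimate into a union bound.
  have key := sum_mul_collisionProb_le h hα x (f := fun x' => if x' ∈ T then 1 else 0) (M := 1)
    (fun _ => by positivity) (fun _ => by split_ifs <;> norm_num)
  simp only [one_mul, Finset.sum_boole, Finset.filter_mem_eq_inter, Finset.univ_inter] at key
  refine le_trans ?_ key
  calc ∑ A ∈ 𝒜.carrier with ∃ x' ∈ T, x' ≠ x ∧ A x' = A x, 𝒜.prob A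
      ≤ ∑ A ∈ 𝒜.carrier, ∑ x' with x' ≠ x, (if x' ∈ T then 1 else 0) *
          (if A x = A x' then 𝒜.prob A else 0) := by
        rw [Finset.sum_filter]
        refine Finset.sum_le_sum fun A hA => ?_
        have h0 := 𝒜.prob_nonneg A hA
        have hn : ∀ x' ∈ Finset.univ.filter (fun x' => x' ≠ x), 0 ≤ (if x' ∈ T then (1 : ℝ) else 0) *
            (if A x = A x' then 𝒜.prob A else 0) := fun x' _ => by
          split_ifs <;> simp [h0]
        split_ifs with hc
        · obtain ⟨x', hT, hne, he⟩ := hc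
          refine le_trans ?_ (Finset.single_le_sum hn (Finset.mem_filter.2 ⟨Finset.mem_univ x', hne⟩))
          simp [hT, he]
        · exact Finset.sum_nonneg hn
    _ = _ := by
        rw [Finset.sum_comm]
        refine Finset.sum_congr rfl fun x' _ => ?_
        rw [← Finset.mul_sum, collisionProb, Finset.sum_filter]

open Classical in
/-- The second moment of the masses of the colour classes of a random function. -/
lemma sum_prob_mul_sum_sq (ℬ : FunctionEnsemble V L) (f : V → ℝ) :
    ∑ B ∈ ℬ.carrier, ℬ.prob B * ∑ m ∈ ℬ.im, (∑ x with B x = m, f x) ^ 2 =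
      ∑ x, f x * ∑ x', f x' * ℬ.collisionProb x x' := by
  have h1 : ∀ B ∈ ℬ.carrier, ∑ m ∈ ℬ.im, (∑ x with B x = m, f x) ^ 2 =
      ∑ x, ∑ x', f x * f x' * (if B x = B x' then 1 else 0) := by
    intro B hB
    calc ∑ m ∈ ℬ.im, (∑ x with B x = m, f x) ^ 2
        = ∑ m ∈ ℬ.im, ∑ x with B x = m, f x * ∑ x' with B x' = B x, f x' := by
          refine Finset.sum_congr rfl fun m _ => ?_
          rw [sq, Finset.sum_mul]
          refine Finset.sum_congr rfl fun x hx => ?_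
          rw [(Finset.mem_filter.1 hx).2]
      _ = ∑ x, f x * ∑ x' with B x' = B x, f x' :=
          Finset.sum_fiberwise_of_maps_to (fun x _ => ℬ.apply_mem_im hB x) _
      _ = _ := by
          refine Finset.sum_congr rfl fun x _ => ?_
          rw [Finset.sum_filter, Finset.mul_sum]
          refine Finset.sum_congr rfl fun x' _ => ?_
          by_cases h : B x = B x' <;> simp [h, eq_comm]
  rw [Finset.sum_congr rfl fun B hB => by rw [h1 B hB]]
  simp_rw [Finset.mul_sum]
  rw [Finset.sum_comm]
  refine Finset.sum_congr rfl fun x _ => ?_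
  rw [Finset.sum_comm]
  refine Finset.sum_congr rfl fun x' _ => ?_
  rw [collisionProb, Finset.sum_filter, Finset.mul_sum, Finset.mul_sum]
  refine Finset.sum_congr rfl fun B _ => ?_
  split_ifs <;> ring

open Classical in
-- The `1` in `1 + β` is the diagonal term: `x` always collides with itself.
lemma sum_mul_sum_mul_collisionProb_le {ℬ : FunctionEnsemble V L} {α β : ℝ}
    (h : ℬ.HashBound α β) (hα : 0 ≤ α) {f : V → ℝ} {M : ℝ} (hf : ∀ x, 0 ≤ f x)
    (hM : ∀ x, f x ≤ M) :
    ∑ x, f x * ∑ x', f x' * ℬ.collisionProb x x' ≤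
      M * (1 + β) * ∑ x, f x + α / (ℬ.im.card : ℝ) * (∑ x, f x) ^ 2 := by
  calc ∑ x, f x * ∑ x', f x' * ℬ.collisionProb x x'
      ≤ ∑ x, f x * (M * (1 + β) + α / (ℬ.im.card : ℝ) * ∑ x', f x') := by
        refine Finset.sum_le_sum fun x _ => mul_le_mul_of_nonneg_left ?_ (hf x)
        have := sum_mul_collisionProb_le h hα x hf hM
        have hx : ∑ x' with ¬ x' ≠ x, f x' * ℬ.collisionProb x x' = f x := by
          rw [Finset.sum_eq_single x] <;> simp +contextual [collisionProb_self]
        rw [← Finset.sum_filter_add_sum_filter_not Finset.univ (fun x' => x' ≠ x), hx]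
        linarith [hM x]
    _ = _ := by rw [← Finset.sum_mul]; ring

open Classical in
/-- A random function of a balanced ensemble nearly equalizes the masses of the colour classes. -/
lemma sum_prob_mul_sum_abs_le {ℬ : FunctionEnsemble V L} [Nonempty V] {α β : ℝ}
    (h : ℬ.HashBound α β) (hα : 0 ≤ α) {f : V → ℝ} {M : ℝ} (hf : ∀ x, 0 ≤ f x)
    (hM : ∀ x, f x ≤ M) :
    ∑ B ∈ ℬ.carrier, ℬ.prob B *
        ∑ m ∈ ℬ.im, |(∑ x, f x) / (ℬ.im.card : ℝ) - ∑ x with B x = m, f x| ≤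
      √((ℬ.im.card : ℝ) * M * (1 + β) * ∑ x, f x + (α - 1) * (∑ x, f x) ^ 2) := by
  set t := ∑ x, f x with ht
  set N := (ℬ.im.card : ℝ) with hN
  have hN0 : 0 < N := ℬ.im_card_pos
  refine Real.le_sqrt_of_sq_le ?_
  -- Jensen for the average over `B`, then Cauchy–Schwarz over the colours. The class masses add up
  -- to `t`, so the cross terms collapse to `- t ^ 2`.
  calc (∑ B ∈ ℬ.carrier, ℬ.prob B * ∑ m ∈ ℬ.im, |t / N - ∑ x with B x = m, f x|) ^ 2
      ≤ ∑ B ∈ ℬ.carrier, ℬ.prob B * (∑ m ∈ ℬ.im, |t / N - ∑ x with B x = m, f x|) ^ 2 :=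
        Real.pow_arith_mean_le_arith_mean_pow _ _ _ ℬ.prob_nonneg ℬ.sum_prob
          (fun _ _ => Finset.sum_nonneg fun _ _ => abs_nonneg _) 2
    _ ≤ ∑ B ∈ ℬ.carrier, ℬ.prob B * (N * ∑ m ∈ ℬ.im, (∑ x with B x = m, f x) ^ 2 - t ^ 2) := by
        refine Finset.sum_le_sum fun B hB => mul_le_mul_of_nonneg_left ?_ (ℬ.prob_nonneg B hB)
        refine sq_sum_le_card_mul_sum_sq.trans (le_of_eq ?_)
        simp_rw [sq_abs, sub_sq]
        have hs : ∑ m ∈ ℬ.im, ∑ x with B x = m, f x = t :=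
          Finset.sum_fiberwise_of_maps_to (fun x _ => ℬ.apply_mem_im hB x) _
        rw [Finset.sum_add_distrib, Finset.sum_sub_distrib, ← Finset.mul_sum, hs,
          Finset.sum_const, nsmul_eq_mul, ← hN]
        field_simp
        ring
    _ = N * ∑ x, f x * ∑ x', f x' * ℬ.collisionProb x x' - t ^ 2 := by
        rw [← ℬ.sum_prob_mul_sum_sq f]
        simp_rw [mul_sub]
        rw [Finset.sum_sub_distrib, ← Finset.sum_mul, ℬ.sum_prob, Finset.mul_sum, one_mul]
        congr 1
        exact Finset.sum_congr rfl fun _ _ => by ring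
    _ ≤ N * (M * (1 + β) * t + α / N * t ^ 2) - t ^ 2 := by
        gcongr
        exact sum_mul_sum_mul_collisionProb_le h hα hf hM
    _ = _ := by field_simp; ring

open Classical in
/-- The expected deficiency of the colour classes of a random function of a balanced ensemble, for
a mass distribution that is at most `s` times the total mass on `T`. -/
lemma sum_prob_mul_sum_max_le {ℬ : FunctionEnsemble V L} [Nonempty V] {α β : ℝ}
    (h : ℬ.HashBound α β) (hα : 1 ≤ α) (hβ : 0 ≤ β) {w : V → ℝ} {s : ℝ} (hs : 0 ≤ s)
    (hw : ∀ x, 0 ≤ w x) (T : Finset V) (hT : ∀ x ∈ T, w x ≤ s * ∑ x, w x) :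
    ∑ B ∈ ℬ.carrier, ℬ.prob B *
        ∑ m ∈ ℬ.im, max ((∑ x, w x) / (ℬ.im.card : ℝ) - ∑ x with B x = m, w x) 0 ≤
      (∑ x with x ∉ T, w x) +
        (∑ x, w x) * √((ℬ.im.card : ℝ) * s * (1 + β) + (α - 1)) := by
  set t := ∑ x, w x with ht
  set N := (ℬ.im.card : ℝ) with hN
  have hN0 : 0 < N := ℬ.im_card_pos
  have ht0 : 0 ≤ t := Finset.sum_nonneg fun x _ => hw x
  -- Truncating to `T` gives the sup bound that the second-moment estimate needs. The mass lost is
  -- charged in full, spread evenly over the `N` colours.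
  let f : V → ℝ := fun x => if x ∈ T then w x else 0
  have hf0 : ∀ x, 0 ≤ f x := fun x => by simp only [f]; split_ifs <;> simp [hw]
  have hfw : ∀ x, f x ≤ w x := fun x => by simp only [f]; split_ifs <;> simp [hw]
  have hfM : ∀ x, f x ≤ s * t := fun x => by
    simp only [f]; split_ifs with hx
    · exact hT x hx
    · positivity
  have hft : ∑ x, f x ≤ t := Finset.sum_le_sum fun x _ => hfw x
  have hft0 : 0 ≤ ∑ x, f x := Finset.sum_nonneg fun x _ => hf0 x
  have hcompl : t - ∑ x, f x = ∑ x with x ∉ T, w x := by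
    rw [ht, ← Finset.sum_sub_distrib, Finset.sum_filter]
    refine Finset.sum_congr rfl fun x _ => ?_
    simp only [f]; split_ifs <;> simp_all
  have key := sum_prob_mul_sum_abs_le h (by linarith) hf0 hfM
  have hsq : √(N * (s * t) * (1 + β) * ∑ x, f x + (α - 1) * (∑ x, f x) ^ 2) ≤
      t * √(N * s * (1 + β) + (α - 1)) := by
    rw [← Real.sqrt_sq ht0, ← Real.sqrt_mul (sq_nonneg t), Real.sqrt_sq ht0]
    apply Real.sqrt_le_sqrt
    have h1 : N * (s * t) * (1 + β) * ∑ x, f x ≤ N * (s * t) * (1 + β) * t := by gcongr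
    have h2 : (α - 1) * (∑ x, f x) ^ 2 ≤ (α - 1) * t ^ 2 := by
      have : 0 ≤ α - 1 := by linarith
      gcongr
    nlinarith
  rw [← hcompl]
  calc ∑ B ∈ ℬ.carrier, ℬ.prob B * ∑ m ∈ ℬ.im, max (t / N - ∑ x with B x = m, w x) 0
      ≤ ∑ B ∈ ℬ.carrier, ℬ.prob B * ((t - ∑ x, f x) +
          ∑ m ∈ ℬ.im, |(∑ x, f x) / N - ∑ x with B x = m, f x|) := by
        refine Finset.sum_le_sum fun B hB => mul_le_mul_of_nonneg_left ?_ (ℬ.prob_nonneg B hB)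
        have hc : t - ∑ x, f x = ∑ m ∈ ℬ.im, (t - ∑ x, f x) / N := by
          rw [Finset.sum_const, nsmul_eq_mul, ← hN]; field_simp
        rw [hc, ← Finset.sum_add_distrib]
        refine Finset.sum_le_sum fun m _ => ?_
        have h1 : ∑ x with B x = m, f x ≤ ∑ x with B x = m, w x :=
          Finset.sum_le_sum fun x _ => hfw x
        have h2 : 0 ≤ (t - ∑ x, f x) / N := div_nonneg (by linarith) hN0.le
        refine max_le ?_ (add_nonneg h2 (abs_nonneg _))
        have h3 := le_abs_self ((∑ x, f x) / N - ∑ x with B x = m, f x)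
        rw [sub_div] at h2 ⊢
        linarith
    _ ≤ _ := by
        rw [Finset.sum_congr rfl fun B _ => mul_add _ _ _, Finset.sum_add_distrib,
          ← Finset.sum_mul, ℬ.sum_prob, one_mul]
        exact add_le_add le_rfl (key.trans hsq)

end FunctionEnsemble

lemma sum_toReal_pmf {V : Type*} [Fintype V] (μ : PMF V) : ∑ x, (μ x).toReal = 1 := by
  rw [← ENNReal.toReal_sum fun x _ => μ.apply_ne_top x, ← tsum_fintype (L := .unconditional _),
    μ.tsum_coe, ENNReal.toReal_one]

/-! ### Posterior probabilities and decoding with hash side information -/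

section Mixture

variable {V O : Type*} [MeasurableSpace O] (μ : PMF V) (W : V → ProbabilityMeasure O)

/-- The part of the joint law of input and output that belongs to the input `x`. -/
noncomputable abbrev joint (x : V) : Measure O := μ x • (W x : Measure O)

instance (x : V) : IsFiniteMeasure (joint μ W x) :=
  Measure.smul_finite _ (μ.apply_ne_top x)

lemma joint_real (x : V) (s : Set O) :
    (joint μ W x).real s = (μ x).toReal * (W x : Measure O).real s := by
  simp [joint, Measure.real, ENNReal.toReal_mul]

variable [Fintype V]

/-- The output law of a channel. -/
noncomputable def mixture : Measure O := ∑ x, joint μ W x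

lemma mixture_real (s : Set O) : (mixture μ W).real s = ∑ x, (joint μ W x).real s := by
  rw [mixture, Measure.real, Measure.finsetSum_apply, ENNReal.toReal_sum]
  · rfl
  · exact fun x _ => measure_ne_top _ _

instance : IsFiniteMeasure (mixture μ W) :=
  ⟨by
    rw [mixture, Measure.finsetSum_apply]
    exact ENNReal.sum_lt_top.2 fun x _ => measure_lt_top _ _⟩

lemma mixture_real_univ : (mixture μ W).real Set.univ = 1 := by
  simp [mixture_real, sum_toReal_pmf, -Measure.smul_apply]

instance : IsProbabilityMeasure (mixture μ W) :=
  ⟨by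
    have := mixture_real_univ μ W
    rwa [Measure.real, ENNReal.toReal_eq_one_iff] at this⟩

lemma joint_le_mixture (x : V) : joint μ W x ≤ mixture μ W := by
  rw [Measure.le_iff]
  intro s _
  rw [mixture, Measure.finsetSum_apply]
  exact Finset.single_le_sum (f := fun x => joint μ W x s) (fun _ _ => zero_le) (Finset.mem_univ x)

lemma joint_ac (x : V) : joint μ W x ≪ mixture μ W :=
  Measure.absolutelyContinuous_of_le (joint_le_mixture μ W x)

/-- The conditional probability of the input `x` given the output. -/
noncomputable def post (x : V) (y : O) : ℝ := ((joint μ W x).rnDeriv (mixture μ W) y).toReal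

lemma post_nonneg (x : V) (y : O) : 0 ≤ post μ W x y := ENNReal.toReal_nonneg

lemma measurable_post (x : V) : Measurable (post μ W x) :=
  (Measure.measurable_rnDeriv _ _).ennreal_toReal

lemma integrable_post (x : V) : Integrable (post μ W x) (mixture μ W) :=
  Measure.integrable_toReal_rnDeriv

lemma setIntegral_post (x : V) (s : Set O) :
    ∫ y in s, post μ W x y ∂(mixture μ W) = (joint μ W x).real s :=
  Measure.setIntegral_toReal_rnDeriv (joint_ac μ W x) s

lemma sum_post_ae_eq_one : ∀ᵐ y ∂(mixture μ W), ∑ x, post μ W x y = 1 := by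
  refine Integrable.ae_eq_of_forall_setIntegral_eq _ _
    (integrable_finsetSum _ fun x _ => integrable_post μ W x) (integrable_const (1 : ℝ)) ?_
  intro s hs _
  rw [integral_finsetSum _ fun x _ => (integrable_post μ W x).integrableOn]
  simp only [setIntegral_post, ← mixture_real]
  simp

lemma post_le_one_ae (x : V) : ∀ᵐ y ∂(mixture μ W), post μ W x y ≤ 1 := by
  filter_upwards [sum_post_ae_eq_one μ W] with y hy
  rw [← hy]
  exact Finset.single_le_sum (f := fun x => post μ W x y) (fun _ _ => post_nonneg _ _ _ _)
    (Finset.mem_univ x)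

/-- Ensures that outputs with posterior zero, where `log (1 / 0) = 0` is a default value, do not
affect the conditional entropy rate. -/
lemma post_pos_ae (x : V) : ∀ᵐ y ∂(joint μ W x), 0 < post μ W x y := by
  filter_upwards [Measure.rnDeriv_pos (joint_ac μ W x),
    (joint_ac μ W x).ae_le (Measure.rnDeriv_lt_top (joint μ W x) (mixture μ W))] with y h1 h2
  exact ENNReal.toReal_pos h1.ne' h2.ne

open Classical in
-- The posteriors of all inputs sum to one.
lemma card_post_ge_ae {t : ℝ} (ht : 0 < t) : ∀ᵐ y ∂(mixture μ W),
    ((Finset.univ.filter fun x => t ≤ post μ W x y).card : ℝ) ≤ 1 / t := by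
  filter_upwards [sum_post_ae_eq_one μ W] with y hy
  rw [le_div_iff₀ ht, ← nsmul_eq_mul, ← Finset.sum_const, ← hy]
  refine (Finset.sum_le_sum fun x hx => (Finset.mem_filter.1 hx).2).trans ?_
  exact Finset.sum_le_sum_of_subset_of_nonneg (Finset.subset_univ _)
    fun _ _ _ => post_nonneg _ _ _ _

lemma measurableSet_post_lt (x : V) (t : ℝ) : MeasurableSet {y | post μ W x y < t} :=
  measurableSet_lt (measurable_post μ W x) measurable_const

lemma joint_real_inter_post_lt_le (x : V) (t : ℝ) (ht : 0 ≤ t) {D : Set O}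
    (hD : MeasurableSet D) :
    (joint μ W x).real (D ∩ {y | post μ W x y < t}) ≤ t * (mixture μ W).real D := by
  have hs : MeasurableSet (D ∩ {y | post μ W x y < t}) := hD.inter (measurableSet_post_lt μ W x t)
  rw [← setIntegral_post]
  calc ∫ y in D ∩ {y | post μ W x y < t}, post μ W x y ∂(mixture μ W)
      ≤ ∫ _ in D ∩ {y | post μ W x y < t}, t ∂(mixture μ W) :=
        setIntegral_mono_on (integrable_post μ W x).integrableOn (integrable_const t).integrableOn
          hs fun y hy => le_of_lt hy.2
    _ = (mixture μ W).real (D ∩ {y | post μ W x y < t}) * t := by simp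
    _ ≤ _ := by
      rw [mul_comm]
      exact mul_le_mul_of_nonneg_left (measureReal_mono Set.inter_subset_left) ht

/-- The probability that the conditional probability of the input given the output is less than
`t`. -/
noncomputable def smallPost (t : ℝ) : ℝ := ∑ x, (joint μ W x).real {y | post μ W x y < t}

lemma smallPost_le_card_mul {t : ℝ} (ht : 0 ≤ t) :
    smallPost μ W t ≤ (Fintype.card V : ℝ) * t := by
  calc smallPost μ W t ≤ ∑ _x : V, t := Finset.sum_le_sum fun x _ => by
        simpa using joint_real_inter_post_lt_le μ W x t ht MeasurableSet.univ
    _ = _ := by simp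

/-- If the input can be estimated reliably from the output, then its conditional probability is
rarely small. -/
lemma smallPost_le_of_estimator {t : ℝ} (ht : 0 ≤ t) (est : O → V)
    (hest : ∀ x, MeasurableSet (est ⁻¹' {x})) :
    smallPost μ W t ≤ ∑ x, (joint μ W x).real {y | est y ≠ x} + t := by
  have h1 : ∑ x, (mixture μ W).real (est ⁻¹' {x}) = 1 := by
    rw [sum_measureReal_preimage_singleton _ fun x _ => hest x]
    simp
  calc smallPost μ W t
      ≤ ∑ x, ((joint μ W x).real {y | est y ≠ x} + t * (mixture μ W).real (est ⁻¹' {x})) := by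
        refine Finset.sum_le_sum fun x _ => ?_
        -- The cells `est ⁻¹' {x}` partition the output space, so the bounds `t * P(cell)` add up to
        -- just `t`, without a factor `|V|`.
        refine le_trans (measureReal_mono (s₂ := {y | est y ≠ x} ∪
          (est ⁻¹' {x} ∩ {y | post μ W x y < t})) ?_) ((measureReal_union_le _ _).trans
          (add_le_add le_rfl (joint_real_inter_post_lt_le μ W x t ht (hest x))))
        intro y hy
        by_cases h : est y = x
        · exact Or.inr ⟨h, hy⟩
        · exact Or.inl h
    _ = _ := by rw [Finset.sum_add_distrib, ← Finset.mul_sum, h1, mul_one]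

/-- The set of outputs at which some other `x'` with the same hash value is at least as likely as
the input `x`. -/
def confusionSet {K : Type*} (A : V → K) (x : V) : Set O :=
  {y | ∃ x', x' ≠ x ∧ A x' = A x ∧ post μ W x y ≤ post μ W x' y}

lemma measurableSet_exists_post_ge (p : V → Prop) (t : ℝ) :
    MeasurableSet {y | ∃ x', p x' ∧ t ≤ post μ W x' y} := by
  have : {y | ∃ x', p x' ∧ t ≤ post μ W x' y} = ⋃ x' ∈ {x' | p x'}, {y | t ≤ post μ W x' y} := by
    ext; simp
  rw [this]
  exact MeasurableSet.biUnion (Set.to_countable _)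
    fun x' _ => measurableSet_le measurable_const (measurable_post μ W x')

/-- The average probability that the maximum a posteriori decoder with hash side information
fails. -/
lemma sum_prob_mul_confusion_le {K : Type*} {𝒜 : FunctionEnsemble V K} {α β t : ℝ}
    (h : 𝒜.HashBound α β) (hα : 0 ≤ α) (ht : 0 < t) :
    ∑ A ∈ 𝒜.carrier, 𝒜.prob A * ∑ x, (joint μ W x).real (confusionSet μ W A x) ≤
      smallPost μ W t + (β + α / (𝒜.im.card : ℝ) * (1 / t)) := by
  classical
  set C := β + α / (𝒜.im.card : ℝ) * (1 / t) with hC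
  -- Unless the true posterior is below `t`, a confusing `x'` has posterior at least `t`. For fixed
  -- `y` the list of such `x'` is independent of `A` and has at most `1 / t` members.
  let E : (V → K) → V → Set O := fun A x => {y | ∃ x', (x' ≠ x ∧ A x' = A x) ∧ t ≤ post μ W x' y}
  have hE : ∀ A x, MeasurableSet (E A x) := fun A x => measurableSet_exists_post_ge μ W _ t
  have havg : ∀ x, ∑ A ∈ 𝒜.carrier, 𝒜.prob A * (joint μ W x).real (E A x) ≤
      C * (μ x).toReal := by
    intro x
    have hint : ∀ A, Integrable ((E A x).indicator fun _ => 𝒜.prob A) (joint μ W x) :=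
      fun A => (integrable_const _).indicator (hE A x)
    calc ∑ A ∈ 𝒜.carrier, 𝒜.prob A * (joint μ W x).real (E A x)
        = ∑ A ∈ 𝒜.carrier, ∫ y, (E A x).indicator (fun _ => 𝒜.prob A) y ∂(joint μ W x) :=
          Finset.sum_congr rfl fun A _ => by
            rw [integral_indicator_const _ (hE A x), smul_eq_mul, mul_comm]
      _ = ∫ y, ∑ A ∈ 𝒜.carrier, (E A x).indicator (fun _ => 𝒜.prob A) y ∂(joint μ W x) :=
          (integral_finsetSum _ fun A _ => hint A).symm
      _ ≤ ∫ _, C ∂(joint μ W x) := by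
          refine integral_mono_ae (integrable_finsetSum _ fun A _ => hint A)
            (integrable_const C) ?_
          filter_upwards [(joint_ac μ W x).ae_le (card_post_ge_ae μ W ht)] with y hy
          have := FunctionEnsemble.prob_collision_le h hα x
            (Finset.univ.filter fun x' => t ≤ post μ W x' y)
          calc ∑ A ∈ 𝒜.carrier, (E A x).indicator (fun _ => 𝒜.prob A) y
              = ∑ A ∈ 𝒜.carrier with ∃ x' ∈ Finset.univ.filter (fun x' => t ≤ post μ W x' y),
                  x' ≠ x ∧ A x' = A x, 𝒜.prob A := by
                rw [Finset.sum_filter]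
                refine Finset.sum_congr rfl fun A _ => ?_
                rw [Set.indicator_apply]
                congr 1
                simp only [E, Set.mem_ofPred_eq, Finset.mem_filter, Finset.mem_univ, true_and,
                  eq_iff_iff]
                exact exists_congr fun _ => and_comm
            _ ≤ _ := this
            _ ≤ C := by rw [hC]; gcongr
      _ = C * (μ x).toReal := by
          rw [integral_const, joint_real]; simp [mul_comm]
  calc ∑ A ∈ 𝒜.carrier, 𝒜.prob A * ∑ x, (joint μ W x).real (confusionSet μ W A x)
      ≤ ∑ A ∈ 𝒜.carrier, 𝒜.prob A * (smallPost μ W t + ∑ x, (joint μ W x).real (E A x)) := by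
        refine Finset.sum_le_sum fun A hA => mul_le_mul_of_nonneg_left ?_ (𝒜.prob_nonneg A hA)
        rw [smallPost, ← Finset.sum_add_distrib]
        refine Finset.sum_le_sum fun x _ => le_trans (measureReal_mono ?_)
          (measureReal_union_le _ _)
        rintro y ⟨x', hne, hA', hle⟩
        by_cases hy : post μ W x y < t
        · exact Or.inl hy
        · exact Or.inr ⟨x', ⟨hne, hA'⟩, (not_lt.1 hy).trans hle⟩
    _ = smallPost μ W t +
          ∑ x, ∑ A ∈ 𝒜.carrier, 𝒜.prob A * (joint μ W x).real (E A x) := by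
        rw [Finset.sum_congr rfl fun A _ => mul_add _ _ _, Finset.sum_add_distrib,
          ← Finset.sum_mul, 𝒜.sum_prob, one_mul, Finset.sum_comm]
        simp_rw [Finset.mul_sum]
    _ ≤ smallPost μ W t + ∑ x, C * (μ x).toReal := by gcongr with x _; exact havg x
    _ = smallPost μ W t + C := by rw [← Finset.mul_sum, sum_toReal_pmf, mul_one]

end Mixture

/-! ### The one-shot error bound -/

section OneShot

open Classical in
/-- The distribution `μ` restricted to the inputs with hash value `c`. -/
noncomputable def fiberWeight {V K : Type*} (μ : PMF V) (A : V → K) (c : K) (x : V) : ℝ :=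
  if A x = c then (μ x).toReal else 0

lemma fiberWeight_nonneg {V K : Type*} {μ : PMF V} (A : V → K) (c : K) (x : V) : 0 ≤ fiberWeight μ A c x := by
  unfold fiberWeight; split_ifs <;> simp

variable {V O K L : Type*} [MeasurableSpace O] [Fintype V] (μ : PMF V)
  (W : V → ProbabilityMeasure O)

/-- `dec` maps a hash value and an output to a most likely input with that hash value. -/
def MaximizesPost (A : V → K) (dec : K → O → V) : Prop :=
  (∀ c ∈ Set.range A, ∀ y, A (dec c y) = c) ∧
  ∀ c ∈ Set.range A, ∀ᵐ y ∂(mixture μ W), ∀ x, A x = c → post μ W x y ≤ post μ W (dec c y) y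

variable {μ}

open Classical in
lemma constrainedMass_eq (A : V → K) (B : V → L) (c : K) (m : L) :
    constrainedMass μ A B c m = ∑ x with B x = m, fiberWeight μ A c x := by
  simp only [constrainedMass, constrainedSet, fiberWeight]
  rw [← Finset.sum_filter, Finset.filter_filter]
  exact Finset.sum_congr (Finset.filter_congr fun _ _ => and_comm) fun _ _ => rfl

open Classical in
lemma sum_sum_fiber (A : V → K) (S : Finset K) (hS : ∀ x, A x ∈ S) (f : V → ℝ) :
    ∑ c ∈ S, ∑ x with A x = c, f x = ∑ x, f x :=
  Finset.sum_fiberwise_of_maps_to (fun x _ => hS x) _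

lemma sum_sum_fiberWeight (A : V → K) (S : Finset K) (hS : ∀ x, A x ∈ S) :
    ∑ c ∈ S, ∑ x, fiberWeight μ A c x = 1 := by
  classical
  rw [← sum_toReal_pmf μ, ← sum_sum_fiber A S hS]
  refine Finset.sum_congr rfl fun c _ => ?_
  rw [Finset.sum_filter]
  exact Finset.sum_congr rfl fun x _ => by simp [fiberWeight]

variable {W}

/-- A wrong message forces the decoder to output some `x' ≠ x` with the same hash value, and by
maximality `x'` is at least as likely as `x`. -/
lemma MaximizesPost.joint_real_error_le {A : V → K} {dec : K → O → V}
    (hdec : MaximizesPost μ W A dec) (B : V → L) (x : V) :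
    (joint μ W x).real {y | channelDecoder B dec (A x) y ≠ B x} ≤
      (joint μ W x).real (confusionSet μ W A x) := by
  refine ENNReal.toReal_mono (measure_ne_top _ _) (measure_mono_ae ?_)
  filter_upwards [(joint_ac μ W x).ae_le (hdec.2 _ (Set.mem_range_self x))] with y hy hne
  refine ⟨dec (A x) y, ?_, hdec.1 _ (Set.mem_range_self x) y, hy x rfl⟩
  intro h
  exact hne (congrArg B h)

open Classical in
-- Compares the uniform message law, of weight `M / |msgs|` after scaling, with the mass `q` that
-- the source gives to message `m`. The excess of the former over `q` is charged as deficiency; the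
-- rest is bounded by the decoding error `e m` under the source.
lemma MaximizesPost.mass_mul_codeError_le {A : V → K} {dec : K → O → V}
    (hdec : MaximizesPost μ W A dec) (B : V → L) (c : K) (msgs : Finset L) :
    (∑ x, fiberWeight μ A c x) * codeError μ W msgs A B c dec ≤
      ∑ m ∈ msgs, max ((∑ x, fiberWeight μ A c x) / (msgs.card : ℝ) -
        ∑ x with B x = m, fiberWeight μ A c x) 0 +
      ∑ x with A x = c, (joint μ W x).real (confusionSet μ W A x) := by
  set M := ∑ x, fiberWeight μ A c x with hM
  have hM0 : 0 ≤ M := Finset.sum_nonneg fun x _ => fiberWeight_nonneg A c x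
  let e : L → ℝ := fun m => ∑ x ∈ constrainedSet A B c m,
    (joint μ W x).real {y | channelDecoder B dec c y ≠ m}
  have he0 : ∀ m, 0 ≤ e m := fun m => Finset.sum_nonneg fun _ _ => measureReal_nonneg
  have heq : ∀ m, e m ≤ constrainedMass μ A B c m := fun m =>
    Finset.sum_le_sum fun x _ => by
      rw [joint_real]
      exact mul_le_of_le_one_right ENNReal.toReal_nonneg measureReal_le_one
  have hesum : ∑ m ∈ msgs, e m ≤
      ∑ x with A x = c, (joint μ W x).real (confusionSet μ W A x) := by
    calc ∑ m ∈ msgs, e m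
        ≤ ∑ m ∈ msgs, ∑ x ∈ (Finset.univ.filter fun x => A x = c) with B x = m,
            (joint μ W x).real (confusionSet μ W A x) := by
          refine Finset.sum_le_sum fun m _ => ?_
          have : constrainedSet A B c m =
              (Finset.univ.filter fun x => A x = c).filter fun x => B x = m := by
            ext; simp [constrainedSet]
          simp only [e, this]
          refine Finset.sum_le_sum fun x hx => ?_
          simp only [Finset.mem_filter, Finset.mem_univ, true_and] at hx
          obtain ⟨rfl, rfl⟩ := hx
          exact hdec.joint_real_error_le B x
      _ ≤ _ := by
          -- `B` is not assumed to take values in `msgs`, so its image is adjoined.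
          rw [← Finset.sum_fiberwise_of_maps_to
            (s := Finset.univ.filter fun x => A x = c) (t := msgs ∪ Finset.univ.image B) (g := B)
            (fun x _ => by simp)]
          exact Finset.sum_le_sum_of_subset_of_nonneg Finset.subset_union_left
            fun _ _ _ => Finset.sum_nonneg fun _ _ => measureReal_nonneg
  have hterm : ∀ m, 0 < constrainedMass μ A B c m →
      M * ∑ x : V, 1 / (msgs.card : ℝ) * encoderLaw μ A B c m x *
        (W x : Measure O).real {y | channelDecoder B dec c y ≠ m} ≤
      max (M / (msgs.card : ℝ) - constrainedMass μ A B c m) 0 + e m := by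
    intro m hm
    set q := constrainedMass μ A B c m with hq
    have h1 : ∑ x : V, 1 / (msgs.card : ℝ) * encoderLaw μ A B c m x *
        (W x : Measure O).real {y | channelDecoder B dec c y ≠ m} =
        1 / (msgs.card : ℝ) * (e m / q) := by
      simp only [e, joint_real, encoderLaw, ← hq]
      rw [Finset.sum_div, Finset.mul_sum, ← Finset.sum_filter_add_sum_filter_not Finset.univ
        (fun x => x ∈ constrainedSet A B c m)]
      rw [Finset.sum_eq_zero (s := Finset.univ.filter fun x => x ∉ constrainedSet A B c m)
        fun x hx => by simp [(Finset.mem_filter.1 hx).2]]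
      rw [add_zero]
      refine Finset.sum_congr (by simp) fun x hx => ?_
      rw [if_pos hx]
      ring
    rw [h1]
    have h2 : e m / q ≤ 1 := (div_le_one hm).2 (heq m)
    have h3 : 0 ≤ e m / q := div_nonneg (he0 m) hm.le
    have h4 : M * (1 / (msgs.card : ℝ) * (e m / q)) =
        (M / (msgs.card : ℝ) - q) * (e m / q) + e m := by
      have : q ≠ 0 := hm.ne'
      rw [sub_mul, mul_div_cancel₀ _ this]; ring
    rw [h4]
    refine add_le_add ?_ le_rfl
    calc (M / (msgs.card : ℝ) - q) * (e m / q)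
        ≤ max (M / (msgs.card : ℝ) - q) 0 * (e m / q) :=
          mul_le_mul_of_nonneg_right (le_max_left _ _) h3
      _ ≤ _ := mul_le_of_le_one_right (le_max_right _ _) h2
  refine le_trans ?_ (add_le_add le_rfl hesum)
  simp_rw [← constrainedMass_eq]
  rw [codeError, mul_add, Finset.mul_sum, Finset.mul_sum, ← Finset.sum_add_distrib,
    Finset.sum_filter, Finset.sum_filter, ← Finset.sum_add_distrib]
  refine Finset.sum_le_sum fun m _ => ?_
  by_cases hm : constrainedMass μ A B c m = 0
  -- An encoder failure costs `M / |msgs|`, which is exactly the deficiency of an empty class.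
  · rw [if_pos hm, if_neg (by simp [hm]), hm, add_zero, sub_zero, mul_one_div]
    exact (le_max_left _ _).trans (le_add_of_nonneg_right (he0 m))
  · have hpos : 0 < constrainedMass μ A B c m :=
      lt_of_le_of_ne (Finset.sum_nonneg fun _ _ => ENNReal.toReal_nonneg) (Ne.symm hm)
    rw [if_neg hm, if_pos hpos, zero_add]
    exact hterm m hpos

open Classical in
/-- The probability that the input is too likely given its hash value. -/
lemma sum_sum_fiberWeight_gt_le (A : V → K) (S : Finset K) (hS : ∀ x, A x ∈ S) {s u : ℝ}
    (hs : 0 < s) (hu : 0 ≤ u) :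
    ∑ c ∈ S, ∑ x with ¬ fiberWeight μ A c x ≤ s * ∑ x, fiberWeight μ A c x,
        fiberWeight μ A c x ≤
      ∑ x with u < (μ x).toReal, (μ x).toReal + (S.card : ℝ) * (u / s) := by
  calc _ ≤ ∑ c ∈ S, (∑ x with A x = c, (if u < (μ x).toReal then (μ x).toReal else 0) + u / s) := by
        refine Finset.sum_le_sum fun c _ => ?_
        set M := ∑ x, fiberWeight μ A c x with hM
        have hn : 0 ≤ ∑ x with A x = c, (if u < (μ x).toReal then (μ x).toReal else 0) :=
          Finset.sum_nonneg fun _ _ => by split_ifs <;> simp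
        -- Either the whole fiber has mass below `u / s`, and there are at most `S.card` such
        -- fibers, or every input exceeding the fraction `s` of its fiber has probability above `u`.
        by_cases h : s * M < u
        · have h1 : M ≤ u / s := (le_div_iff₀ hs).2 (by linarith)
          have h2 : ∑ x with ¬ fiberWeight μ A c x ≤ s * M, fiberWeight μ A c x ≤ M :=
            Finset.sum_le_sum_of_subset_of_nonneg (Finset.subset_univ _)
              fun _ _ _ => fiberWeight_nonneg _ _ _
          linarith
        · have h1 : ∑ x with ¬ fiberWeight μ A c x ≤ s * M, fiberWeight μ A c x ≤
              ∑ x with A x = c, (if u < (μ x).toReal then (μ x).toReal else 0) := by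
            rw [Finset.sum_filter, Finset.sum_filter]
            refine Finset.sum_le_sum fun x _ => ?_
            by_cases hA : A x = c
            · simp only [fiberWeight, hA, if_true]
              split_ifs <;> linarith
            · simp [fiberWeight, hA]
          have : 0 ≤ u / s := by positivity
          linarith
    _ = _ := by
        rw [Finset.sum_add_distrib, sum_sum_fiber A S hS, Finset.sum_filter]
        simp

open Classical in
/-- One-shot reliability of the code built from a hash ensemble `𝒜` and a balanced ensemble `ℬ`. -/
theorem exists_codeError_lt {𝒜 : FunctionEnsemble V K} {ℬ : FunctionEnsemble V L}
    {αA βA αB βB s t u δ : ℝ} (hA : 𝒜.HashBound αA βA) (hB : ℬ.HashBound αB βB)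
    (hαA : 0 ≤ αA) (hαB : 1 ≤ αB) (hβB : 0 ≤ βB) (hs : 0 < s) (ht : 0 < t) (hu : 0 ≤ u)
    {dec : (V → K) → K → O → V} (hdec : ∀ A ∈ 𝒜.carrier, MaximizesPost μ W A (dec A))
    (hδ : ∑ x with u < (μ x).toReal, (μ x).toReal + (𝒜.im.card : ℝ) * (u / s) +
      √((ℬ.im.card : ℝ) * s * (1 + βB) + (αB - 1)) +
      (smallPost μ W t + (βA + αA / (𝒜.im.card : ℝ) * (1 / t))) < δ) :
    ∃ A ∈ 𝒜.carrier, ∃ B ∈ ℬ.carrier, ∃ c ∈ 𝒜.im,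
      codeError μ W ℬ.im A B c (dec A) < δ := by
  have : Nonempty V := ⟨μ.support_nonempty.some⟩
  -- If all triples had error at least `δ`, so would the average with weights `P(A x = c)` on `c`
  -- and the ensemble probabilities on `A` and `B`.
  by_contra! hcon
  refine absurd hδ (not_lt.2 ?_)
  set a := ∑ x with u < (μ x).toReal, (μ x).toReal + (𝒜.im.card : ℝ) * (u / s)
  set b := √((ℬ.im.card : ℝ) * s * (1 + βB) + (αB - 1))
  have hstep : ∀ A ∈ 𝒜.carrier,
      δ ≤ a + b + ∑ x, (joint μ W x).real (confusionSet μ W A x) := by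
    intro A hAc
    let D : (V → L) → K → ℝ := fun B c => ∑ m ∈ ℬ.im,
      max ((∑ x, fiberWeight μ A c x) / (ℬ.im.card : ℝ) -
        ∑ x with B x = m, fiberWeight μ A c x) 0
    have hB1 : ∀ B ∈ ℬ.carrier, δ ≤ ∑ c ∈ 𝒜.im, D B c +
        ∑ x, (joint μ W x).real (confusionSet μ W A x) := by
      intro B hBc
      calc δ = ∑ c ∈ 𝒜.im, (∑ x, fiberWeight μ A c x) * δ := by
            rw [← Finset.sum_mul, sum_sum_fiberWeight A _ (𝒜.apply_mem_im hAc), one_mul]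
        _ ≤ ∑ c ∈ 𝒜.im, (D B c +
              ∑ x with A x = c, (joint μ W x).real (confusionSet μ W A x)) :=
            Finset.sum_le_sum fun c hc => le_trans
              (mul_le_mul_of_nonneg_left (hcon A hAc B hBc c hc)
                (Finset.sum_nonneg fun x _ => fiberWeight_nonneg A c x))
              ((hdec A hAc).mass_mul_codeError_le B c ℬ.im)
        _ = _ := by
            rw [Finset.sum_add_distrib, sum_sum_fiber A _ (𝒜.apply_mem_im hAc)]
    calc δ = ∑ B ∈ ℬ.carrier, ℬ.prob B * δ := by rw [← Finset.sum_mul, ℬ.sum_prob, one_mul]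
      _ ≤ ∑ B ∈ ℬ.carrier, ℬ.prob B * (∑ c ∈ 𝒜.im, D B c +
            ∑ x, (joint μ W x).real (confusionSet μ W A x)) :=
          Finset.sum_le_sum fun B hBc => mul_le_mul_of_nonneg_left (hB1 B hBc) (ℬ.prob_nonneg B hBc)
      _ = ∑ c ∈ 𝒜.im, ∑ B ∈ ℬ.carrier, ℬ.prob B * D B c +
            ∑ x, (joint μ W x).real (confusionSet μ W A x) := by
          rw [Finset.sum_congr rfl fun B _ => mul_add _ _ _, Finset.sum_add_distrib,
            ← Finset.sum_mul, ℬ.sum_prob, one_mul, Finset.sum_comm]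
          simp_rw [Finset.mul_sum]
      _ ≤ ∑ c ∈ 𝒜.im, (∑ x with ¬ fiberWeight μ A c x ≤ s * ∑ x, fiberWeight μ A c x,
            fiberWeight μ A c x + (∑ x, fiberWeight μ A c x) * b) +
            ∑ x, (joint μ W x).real (confusionSet μ W A x) := by
          refine add_le_add (Finset.sum_le_sum fun c _ => ?_) le_rfl
          have := FunctionEnsemble.sum_prob_mul_sum_max_le hB hαB hβB hs.le
            (fiberWeight_nonneg (μ := μ) A c)
            (Finset.univ.filter fun x => fiberWeight μ A c x ≤ s * ∑ x, fiberWeight μ A c x)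
            (fun x hx => (Finset.mem_filter.1 hx).2)
          simpa using this
      _ ≤ _ := by
          rw [Finset.sum_add_distrib, ← Finset.sum_mul,
            sum_sum_fiberWeight A _ (𝒜.apply_mem_im hAc), one_mul]
          exact add_le_add (add_le_add
            (sum_sum_fiberWeight_gt_le A _ (𝒜.apply_mem_im hAc) hs hu) le_rfl) le_rfl
  calc δ = ∑ A ∈ 𝒜.carrier, 𝒜.prob A * δ := by rw [← Finset.sum_mul, 𝒜.sum_prob, one_mul]
    _ ≤ ∑ A ∈ 𝒜.carrier, 𝒜.prob A *
          (a + b + ∑ x, (joint μ W x).real (confusionSet μ W A x)) :=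
        Finset.sum_le_sum fun A hAc => mul_le_mul_of_nonneg_left (hstep A hAc) (𝒜.prob_nonneg A hAc)
    _ = a + b + ∑ A ∈ 𝒜.carrier, 𝒜.prob A *
          ∑ x, (joint μ W x).real (confusionSet μ W A x) := by
        rw [Finset.sum_congr rfl fun A _ => mul_add _ _ _, Finset.sum_add_distrib,
          ← Finset.sum_mul, 𝒜.sum_prob, one_mul]
    _ ≤ _ := add_le_add le_rfl (sum_prob_mul_confusion_le μ W hA hαA ht)

end OneShot

/-! ### Exponential scales and tail probabilities -/

/-- `2 ^ (n a)`. -/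
noncomputable def expRate (n : ℕ) (a : ℝ) : ℝ := (2 : ℝ) ^ ((n : ℝ) * a)

lemma expRate_pos (n : ℕ) (a : ℝ) : 0 < expRate n a := Real.rpow_pos_of_pos two_pos _

lemma expRate_add (n : ℕ) (a b : ℝ) : expRate n (a + b) = expRate n a * expRate n b := by
  rw [expRate, mul_add, Real.rpow_add two_pos]; rfl

lemma expRate_neg (n : ℕ) (a : ℝ) : expRate n (-a) = (expRate n a)⁻¹ := by
  rw [expRate, mul_neg, Real.rpow_neg two_pos.le]; rfl

lemma expRate_zero (n : ℕ) : expRate n 0 = 1 := by simp [expRate]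

lemma expRate_mono (n : ℕ) : Monotone (expRate n) := fun _ _ h =>
  Real.rpow_le_rpow_of_exponent_le one_le_two (mul_le_mul_of_nonneg_left h n.cast_nonneg)

lemma one_le_expRate (n : ℕ) {a : ℝ} (ha : 0 ≤ a) : 1 ≤ expRate n a :=
  expRate_zero n ▸ expRate_mono n ha

lemma expRate_eq_pow (n : ℕ) (a : ℝ) : expRate n a = ((2 : ℝ) ^ a) ^ n := by
  rw [expRate, mul_comm, Real.rpow_mul_natCast two_pos.le]

lemma tendsto_expRate {a : ℝ} (ha : a < 0) : Tendsto (fun n => expRate n a) atTop (𝓝 0) := by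
  simp_rw [expRate_eq_pow]
  exact tendsto_pow_atTop_nhds_zero_of_lt_one (by positivity)
    (Real.rpow_lt_one_of_one_lt_of_neg one_lt_two ha)

lemma normalized_logb_lt_iff {n : ℕ} (hn : 0 < n) {p a : ℝ} (hp : 0 < p) :
    1 / (n : ℝ) * Real.logb 2 p < a ↔ p < expRate n a := by
  have hn' : (0 : ℝ) < n := by exact_mod_cast hn
  rw [expRate, ← Real.logb_lt_iff_lt_rpow one_lt_two hp, one_div, inv_mul_lt_iff₀ hn']

lemma lt_normalized_logb_iff {n : ℕ} (hn : 0 < n) {p a : ℝ} (hp : 0 < p) :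
    a < 1 / (n : ℝ) * Real.logb 2 p ↔ expRate n a < p := by
  have hn' : (0 : ℝ) < n := by exact_mod_cast hn
  rw [expRate, ← Real.lt_logb_iff_rpow_lt one_lt_two hp, one_div, lt_inv_mul_iff₀ hn']

lemma normalized_logb_inv_lt_iff {n : ℕ} (hn : 0 < n) {p a : ℝ} (hp : 0 < p) :
    1 / (n : ℝ) * Real.logb 2 (1 / p) < a ↔ expRate n (-a) < p := by
  rw [normalized_logb_lt_iff hn (by positivity), expRate_neg, one_div,
    inv_lt_comm₀ hp (expRate_pos n a)]

lemma lt_normalized_logb_inv_iff {n : ℕ} (hn : 0 < n) {p a : ℝ} (hp : 0 < p) :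
    a < 1 / (n : ℝ) * Real.logb 2 (1 / p) ↔ p < expRate n (-a) := by
  rw [lt_normalized_logb_iff hn (by positivity), expRate_neg, one_div,
    lt_inv_comm₀ (expRate_pos n a) hp]

open Classical in
/-- The probability that the probability of the input exceeds `u`. -/
noncomputable def likelyMass {V : Type*} [Fintype V] (μ : PMF V) (u : ℝ) : ℝ :=
  ∑ x with u < (μ x).toReal, (μ x).toReal

section OneShot

variable {V O : Type*} [Fintype V] [MeasurableSpace O] (μ : PMF V) (W : V → ProbabilityMeasure O)

lemma likelyMass_nonneg (u : ℝ) : 0 ≤ likelyMass μ u :=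
  Finset.sum_nonneg fun _ _ => ENNReal.toReal_nonneg

lemma likelyMass_anti {u u' : ℝ} (h : u ≤ u') : likelyMass μ u' ≤ likelyMass μ u :=
  Finset.sum_le_sum_of_subset_of_nonneg
    (fun x hx => by
      simp only [Finset.mem_filter, Finset.mem_univ, true_and] at hx ⊢
      exact h.trans_lt hx) fun _ _ _ => ENNReal.toReal_nonneg

lemma likelyMass_of_one_le {u : ℝ} (hu : 1 ≤ u) : likelyMass μ u = 0 := by
  rw [likelyMass, Finset.filter_false_of_mem, Finset.sum_empty]
  intro x _
  exact not_lt.2 (le_trans (ENNReal.toReal_le_of_le_ofReal one_pos.le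
    (by simpa using μ.coe_le_one x)) hu)

/-- Inputs of probability at most `u` carry at most `|V| u` altogether. This bounds the entropy rate
by `log |𝒳|`. -/
lemma one_sub_card_mul_le_likelyMass (u : ℝ) (hu : 0 ≤ u) :
    1 - (Fintype.card V : ℝ) * u ≤ likelyMass μ u := by
  classical
  rw [sub_le_iff_le_add, ← sum_toReal_pmf μ,
    ← Finset.sum_filter_add_sum_filter_not Finset.univ (fun x => u < (μ x).toReal)]
  refine add_le_add (le_of_eq (Finset.sum_congr (Finset.filter_congr_decidable _ _ _) fun _ _ => rfl)) ?_
  calc ∑ x with ¬ u < (μ x).toReal, (μ x).toReal ≤ ∑ x with ¬ u < (μ x).toReal, u :=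
        Finset.sum_le_sum fun x hx => not_lt.1 (Finset.mem_filter.1 hx).2
    _ ≤ ∑ _x : V, u := Finset.sum_le_sum_of_subset_of_nonneg (Finset.subset_univ _) fun _ _ _ => hu
    _ = _ := by simp

lemma smallPost_nonneg (t : ℝ) : 0 ≤ smallPost μ W t :=
  Finset.sum_nonneg fun _ _ => measureReal_nonneg

lemma smallPost_mono : Monotone (smallPost μ W) := fun _ _ h =>
  Finset.sum_le_sum fun _ _ => measureReal_mono fun _ hy => lt_of_lt_of_le hy h

lemma smallPost_of_one_lt {t : ℝ} (ht : 1 < t) : smallPost μ W t = 1 := by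
  rw [← mixture_real_univ μ W, mixture_real]
  refine Finset.sum_congr rfl fun x _ => measureReal_congr ?_
  filter_upwards [(joint_ac μ W x).ae_le (post_le_one_ae μ W x)] with y hy
  exact eq_true (hy.trans_lt ht) |>.trans (eq_true (Set.mem_univ y)).symm

end OneShot

/-! ### Spectral entropy rates -/

section Rates

lemma GeneralSource.nonempty {𝒳 : Type*} (X : GeneralSource 𝒳) : Nonempty 𝒳 :=
  ⟨(X 1).support_nonempty.some 0⟩

variable {𝒳 𝒴 : Type*} [Fintype 𝒳] [MeasurableSpace 𝒴] {X : GeneralSource 𝒳}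
  {W : GeneralChannel 𝒳 𝒴}

lemma infEntropyRate_eq (X : GeneralSource 𝒳) : infEntropyRate X =
    sSup {θ : ℝ | Tendsto (fun n => likelyMass (X n) (expRate n (-θ))) atTop (𝓝 0)} := by
  classical
  rw [infEntropyRate]
  congr 1
  ext θ
  refine tendsto_congr' ?_
  filter_upwards [eventually_gt_atTop 0] with n hn
  rw [likelyMass, Finset.sum_filter, Finset.sum_filter]
  refine Finset.sum_congr rfl fun x _ => ?_
  -- For an input of probability zero the two conditions may disagree, but its weight is zero.
  rcases (ENNReal.toReal_nonneg (a := X n x)).eq_or_lt with h | h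
  · simp [← h]
  · simp only [normalized_logb_inv_lt_iff hn h]

lemma condSupEntropyRate_eq (X : GeneralSource 𝒳) (W : GeneralChannel 𝒳 𝒴) :
    condSupEntropyRate X W =
    sInf {θ : ℝ | Tendsto (fun n => smallPost (X n) (W n) (expRate n (-θ))) atTop (𝓝 0)} := by
  rw [condSupEntropyRate]
  congr 1
  ext θ
  refine tendsto_congr' ?_
  filter_upwards [eventually_gt_atTop 0] with n hn
  refine Finset.sum_congr rfl fun x _ => ?_
  rw [← joint_real (X n) (W n)]
  refine measureReal_congr ?_
  filter_upwards [post_pos_ae (X n) (W n) x] with y hy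
  exact propext (lt_normalized_logb_inv_iff hn hy)

lemma card_block_eq [Nonempty 𝒳] (n : ℕ) :
    (Fintype.card (Fin n → 𝒳) : ℝ) = expRate n (Real.logb 2 (Fintype.card 𝒳)) := by
  rw [expRate_eq_pow, Real.rpow_logb two_pos (by norm_num)
    (by exact_mod_cast Fintype.card_pos)]
  simp

lemma tendsto_card_block_mul [Nonempty 𝒳] {θ : ℝ} (h : Real.logb 2 (Fintype.card 𝒳) < θ) :
    Tendsto (fun n => (Fintype.card (Fin n → 𝒳) : ℝ) * expRate n (-θ)) atTop (𝓝 0) := by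
  simp_rw [card_block_eq, ← expRate_add]
  exact tendsto_expRate (by linarith)

lemma le_of_tendsto_likelyMass {θ : ℝ}
    (h : Tendsto (fun n => likelyMass (X n) (expRate n (-θ))) atTop (𝓝 0)) :
    θ ≤ Real.logb 2 (Fintype.card 𝒳) := by
  have := GeneralSource.nonempty X
  by_contra! hlt
  have h1 := (tendsto_card_block_mul hlt).const_sub 1
  have h2 := le_of_tendsto_of_tendsto' h1 h fun n =>
    one_sub_card_mul_le_likelyMass (X n) _ (expRate_pos n _).le
  norm_num at h2

lemma bddAbove_likelyMass : BddAbove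
    {θ : ℝ | Tendsto (fun n => likelyMass (X n) (expRate n (-θ))) atTop (𝓝 0)} :=
  ⟨_, fun _ h => le_of_tendsto_likelyMass h⟩

lemma tendsto_likelyMass_of_nonpos {θ : ℝ} (hθ : θ ≤ 0) :
    Tendsto (fun n => likelyMass (X n) (expRate n (-θ))) atTop (𝓝 0) := by
  simp_rw [likelyMass_of_one_le _ (one_le_expRate _ (neg_nonneg.2 hθ))]
  exact tendsto_const_nhds

lemma tendsto_likelyMass {θ : ℝ} (hθ : θ < infEntropyRate X) :
    Tendsto (fun n => likelyMass (X n) (expRate n (-θ))) atTop (𝓝 0) := by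
  rw [infEntropyRate_eq] at hθ
  obtain ⟨θ', h', hlt⟩ := exists_lt_of_lt_csSup ⟨0, tendsto_likelyMass_of_nonpos le_rfl⟩ hθ
  exact squeeze_zero (fun n => likelyMass_nonneg _ _)
    (fun n => likelyMass_anti _ (expRate_mono n (by linarith))) h'

lemma le_infEntropyRate {h : ℝ}
    (H : ∀ θ < h, Tendsto (fun n => likelyMass (X n) (expRate n (-θ))) atTop (𝓝 0)) :
    h ≤ infEntropyRate X := by
  rw [infEntropyRate_eq]
  exact le_of_forall_lt fun c hc => by
    obtain ⟨d, hcd, hd⟩ := exists_between hc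
    exact hcd.trans_le (le_csSup bddAbove_likelyMass (H d hd))

lemma infEntropyRate_nonneg : 0 ≤ infEntropyRate X :=
  le_infEntropyRate fun _ hθ => tendsto_likelyMass_of_nonpos hθ.le

lemma infEntropyRate_le : infEntropyRate X ≤ Real.logb 2 (Fintype.card 𝒳) := by
  rw [infEntropyRate_eq]
  exact csSup_le ⟨0, tendsto_likelyMass_of_nonpos le_rfl⟩ fun _ h => le_of_tendsto_likelyMass h

lemma tendsto_smallPost_of_lt {θ : ℝ} (h : Real.logb 2 (Fintype.card 𝒳) < θ) :
    Tendsto (fun n => smallPost (X n) (W n) (expRate n (-θ))) atTop (𝓝 0) := by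
  have := GeneralSource.nonempty X
  exact squeeze_zero (fun n => smallPost_nonneg _ _ _)
    (fun n => smallPost_le_card_mul _ _ (expRate_pos n _).le) (tendsto_card_block_mul h)

lemma nonneg_of_tendsto_smallPost {θ : ℝ}
    (h : Tendsto (fun n => smallPost (X n) (W n) (expRate n (-θ))) atTop (𝓝 0)) : 0 ≤ θ := by
  by_contra! hlt
  have h1 : Tendsto (fun n => smallPost (X n) (W n) (expRate n (-θ))) atTop (𝓝 1) := by
    refine tendsto_const_nhds.congr' ?_
    filter_upwards [eventually_gt_atTop 0] with n hn
    refine (smallPost_of_one_lt _ _ ?_).symm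
    exact Real.one_lt_rpow one_lt_two (mul_pos (by exact_mod_cast hn) (by linarith))
  exact zero_ne_one (tendsto_nhds_unique h h1)

lemma bddBelow_smallPost : BddBelow
    {θ : ℝ | Tendsto (fun n => smallPost (X n) (W n) (expRate n (-θ))) atTop (𝓝 0)} :=
  ⟨0, fun _ h => nonneg_of_tendsto_smallPost h⟩

lemma nonempty_smallPost :
    {θ : ℝ | Tendsto (fun n => smallPost (X n) (W n) (expRate n (-θ))) atTop (𝓝 0)}.Nonempty :=
  ⟨_, tendsto_smallPost_of_lt (lt_add_one _)⟩

lemma tendsto_smallPost {θ : ℝ} (hθ : condSupEntropyRate X W < θ) :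
    Tendsto (fun n => smallPost (X n) (W n) (expRate n (-θ))) atTop (𝓝 0) := by
  rw [condSupEntropyRate_eq] at hθ
  obtain ⟨θ', h', hlt⟩ := exists_lt_of_csInf_lt nonempty_smallPost hθ
  exact squeeze_zero (fun n => smallPost_nonneg _ _ _)
    (fun n => smallPost_mono _ _ (expRate_mono n (by linarith))) h'

lemma condSupEntropyRate_le {g : ℝ}
    (H : ∀ θ, g < θ → Tendsto (fun n => smallPost (X n) (W n) (expRate n (-θ))) atTop (𝓝 0)) :
    condSupEntropyRate X W ≤ g := by
  rw [condSupEntropyRate_eq]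
  exact le_of_forall_gt fun c hc => by
    obtain ⟨d, hd, hcd⟩ := exists_between hc
    exact (csInf_le bddBelow_smallPost (H d hd)).trans_lt hcd

lemma condSupEntropyRate_nonneg : 0 ≤ condSupEntropyRate X W := by
  rw [condSupEntropyRate_eq]
  exact le_csInf nonempty_smallPost fun _ h => nonneg_of_tendsto_smallPost h

lemma condSupEntropyRate_le_logb : condSupEntropyRate X W ≤ Real.logb 2 (Fintype.card 𝒳) :=
  condSupEntropyRate_le fun _ h => tendsto_smallPost_of_lt h

end Rates

lemma eventually_le_expRate {α : ℕ → ℝ} {ε : ℝ} (hε : 0 < ε)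
    (h : limsup (fun n => normalizedLog n (α n)) atTop = 0) :
    ∀ᶠ n in atTop, α n ≤ expRate n ε := by
  have h1 : limsup (fun n => normalizedLog n (α n)) atTop < ((ε : ℝ) : EReal) := by
    rw [h]; exact_mod_cast hε
  filter_upwards [eventually_lt_of_limsup_lt h1, eventually_gt_atTop 0] with n hn hn0
  by_cases hpos : 0 < α n
  · rw [normalizedLog, if_pos hpos, EReal.coe_lt_coe_iff] at hn
    exact ((normalized_logb_lt_iff hn0 hpos).1 hn).le
  -- A nonpositive `α n` has normalized logarithm `⊥` and satisfies the bound trivially.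
  · exact (not_lt.1 hpos).trans (expRate_pos n ε).le

/-! ### Reliability for large block lengths -/

section Reliability

variable {𝒳 𝒴 : Type*} [Fintype 𝒳] [MeasurableSpace 𝒴]

lemma im_card_pos_of_source (X : GeneralSource 𝒳) {n : ℕ} {L : Type*}
    (𝒜 : FunctionEnsemble (Fin n → 𝒳) L) : 0 < (𝒜.im.card : ℝ) :=
  have : Nonempty (Fin n → 𝒳) := ⟨(X n).support_nonempty.some⟩
  𝒜.im_card_pos

theorem eventually_exists_codeError_lt {W : GeneralChannel 𝒳 𝒴} {X : GeneralSource 𝒳}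
    {K L : ℕ → Type*} {𝒜 : (n : ℕ) → FunctionEnsemble (Fin n → 𝒳) (K n)}
    {ℬ : (n : ℕ) → FunctionEnsemble (Fin n → 𝒳) (L n)} {αA βA αB βB : ℕ → ℝ} {r R : ℝ}
    (hA : CollisionResistance 𝒜 αA βA) (hB : BalancedColoring ℬ αB βB)
    (hr : Tendsto (fun n => ensembleRate n (𝒜 n)) atTop (𝓝 r))
    (hR : Tendsto (fun n => ensembleRate n (ℬ n)) atTop (𝓝 R))
    (h1 : condSupEntropyRate X W < r) (h2 : r + R < infEntropyRate X)
    (dec : (n : ℕ) → ((Fin n → 𝒳) → K n) → K n → (Fin n → 𝒴) → (Fin n → 𝒳))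
    (hdec : ∀ n, ∀ A ∈ (𝒜 n).carrier, IsMAPDecoder X W n A (dec n A)) {δ : ℝ} (hδ : 0 < δ) :
    ∀ᶠ n : ℕ in atTop, ∃ A ∈ (𝒜 n).carrier, ∃ B ∈ (ℬ n).carrier, ∃ c ∈ (𝒜 n).im,
      codeError (X n) (W n) (ℬ n).im A B c (dec n A) < δ := by
  obtain ⟨θ₁, hθ₁, hθ₁r⟩ := exists_between h1
  obtain ⟨θ₂, hθ₂r, hθ₂⟩ := exists_between h2
  -- The exponents to be made negative are `r + R - θ₂ + 4 ε` and `θ₁ - r + 2 ε`; both become at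
  -- most `-ε`.
  obtain ⟨ε, hε, hε1, hε2⟩ : ∃ ε : ℝ, 0 < ε ∧ 3 * ε ≤ r - θ₁ ∧ 5 * ε ≤ θ₂ - (r + R) :=
    ⟨min ((r - θ₁) / 3) ((θ₂ - (r + R)) / 5),
      lt_min (by linarith) (by linarith),
      by linarith [min_le_left ((r - θ₁) / 3) ((θ₂ - (r + R)) / 5)],
      by linarith [min_le_right ((r - θ₁) / 3) ((θ₂ - (r + R)) / 5)]⟩
  -- `η` dominates both `αB - 1`, which enters under the square root, and `βA`. Neither need decay
  -- exponentially.
  obtain ⟨η, hηδ, hη⟩ : ∃ η : ℝ, √η + η < δ ∧ 0 < η := by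
    have hc : Tendsto (fun η : ℝ => √η + η) (𝓝[>] 0) (𝓝 0) := by
      have : Continuous fun η : ℝ => √η + η := by fun_prop
      simpa using (this.tendsto 0).mono_left nhdsWithin_le_nhds
    exact ((hc.eventually_lt_const hδ).and self_mem_nhdsWithin).exists
  have hlim : Tendsto (fun n => likelyMass (X n) (expRate n (-θ₂)) +
      expRate n (r + ε - θ₂ + (R + 3 * ε)) + √(expRate n (-ε) + η) +
      (smallPost (X n) (W n) (expRate n (-θ₁)) + (η + expRate n (ε - (r - ε) + θ₁))))
      atTop (𝓝 (0 + 0 + √(0 + η) + (0 + (η + 0)))) := by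
    refine (((tendsto_likelyMass hθ₂).add (tendsto_expRate (by linarith))).add
      ((tendsto_expRate (by linarith)).add_const η).sqrt).add
      ((tendsto_smallPost hθ₁).add (tendsto_const_nhds.add (tendsto_expRate (by linarith))))
  rw [add_zero, zero_add, zero_add, zero_add, add_zero] at hlim
  have hαB : limsup (fun n => (αB n : EReal)) atTop < ((1 + η : ℝ) : EReal) := by
    rw [hB.limsup_alpha]; exact_mod_cast (by linarith : (1 : ℝ) < 1 + η)
  have hβA : limsup (fun n => (βA n : EReal)) atTop < ((η : ℝ) : EReal) := by
    rw [hA.limsup_beta]; exact_mod_cast hη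
  filter_upwards [hlim.eventually_lt_const hηδ, hA.hash, hB.hash,
    eventually_lt_of_limsup_lt hαB, eventually_lt_of_limsup_lt hβA,
    eventually_le_expRate hε hA.limsup_alpha, eventually_le_expRate hε hB.limsup_beta,
    hr.eventually_lt_const (lt_add_of_pos_right r hε),
    hr.eventually_const_lt (sub_lt_self r hε), hR.eventually_lt_const (lt_add_of_pos_right R hε),
    eventually_gt_atTop 0] with n hn hashA hashB hαBn hβAn hαAn hβBn hr1 hr2 hR1 hn0
  have hNA := im_card_pos_of_source X (𝒜 n)
  have hNB := im_card_pos_of_source X (ℬ n)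
  rw [ensembleRate, normalized_logb_lt_iff hn0 hNA] at hr1
  rw [ensembleRate, lt_normalized_logb_iff hn0 hNA] at hr2
  rw [ensembleRate, normalized_logb_lt_iff hn0 hNB] at hR1
  rw [EReal.coe_lt_coe_iff] at hαBn hβAn
  -- In the exponent `R + 3 * ε` of `s`, one `ε` absorbs the fluctuation of `|Im ℬ|`, one absorbs `1
  -- + βB`, and one is left for decay. `hdec n` fits because `IsMAPDecoder` unfolds to
  -- `MaximizesPost`.
  refine exists_codeError_lt (αA := expRate n ε) (βA := η) (αB := 1 + η)
    (βB := expRate n ε - 1) (s := expRate n (-(R + 3 * ε))) (t := expRate n (-θ₁))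
    (u := expRate n (-θ₂)) (hashA.mono hαAn hβAn.le) (hashB.mono hαBn.le (by linarith))
    (expRate_pos _ _).le (by linarith) (by linarith [one_le_expRate n hε.le]) (expRate_pos _ _)
    (expRate_pos _ _) (expRate_pos _ _).le (hdec n) (lt_of_le_of_lt ?_ hn)
  have e1 : ((𝒜 n).im.card : ℝ) * (expRate n (-θ₂) / expRate n (-(R + 3 * ε))) ≤
      expRate n (r + ε - θ₂ + (R + 3 * ε)) := by
    rw [expRate_add, sub_eq_add_neg, expRate_add n _ (-θ₂), expRate_neg n (R + 3 * ε), div_inv_eq_mul,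
      ← mul_assoc]
    have := expRate_pos n (-θ₂)
    have := expRate_pos n (R + 3 * ε)
    gcongr
  have e2 : ((ℬ n).im.card : ℝ) * expRate n (-(R + 3 * ε)) * (1 + (expRate n ε - 1)) ≤
      expRate n (-ε) := by
    have : expRate n (-ε) = expRate n (R + ε) * expRate n (-(R + 3 * ε)) * expRate n ε := by
      rw [← expRate_add, ← expRate_add]; congr 1; ring
    rw [this, add_sub_cancel]
    have := expRate_pos n (-(R + 3 * ε))
    have := expRate_pos n ε
    gcongr
  have e3 : expRate n ε / ((𝒜 n).im.card : ℝ) * (1 / expRate n (-θ₁)) ≤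
      expRate n (ε - (r - ε) + θ₁) := by
    have h0 := expRate_pos n θ₁
    have h1 := expRate_pos n ε
    have h2 := expRate_pos n (r - ε)
    rw [expRate_add, sub_eq_add_neg, expRate_add, expRate_neg, expRate_neg, one_div, inv_inv,
      ← div_eq_mul_inv]
    gcongr
  rw [add_sub_cancel_left]
  refine add_le_add (add_le_add (add_le_add ?_ e1) (Real.sqrt_le_sqrt (by linarith)))
    (by linarith)
  exact le_of_eq (Finset.sum_congr (Finset.filter_congr_decidable _ _ _) fun _ _ => rfl)

end Reliability

/-! ### Splicing sources, and attainment of the supremum -/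

/-- If for every `k` and all large `n` some admissible element has the property `Q k n`, and these
properties become stronger with `k`, then a single sequence has all of them eventually. -/
lemma exists_diagonal {S : ℕ → Type*} {P : (n : ℕ) → S n → Prop} {Q : ℕ → (n : ℕ) → S n → Prop}
    (hP : ∀ n, ∃ x, P n x) (hQ : ∀ n x, Antitone fun k => Q k n x)
    (H : ∀ k, ∀ᶠ n in atTop, ∃ x, P n x ∧ Q k n x) :
    ∃ x : (n : ℕ) → S n, (∀ n, P n (x n)) ∧ ∀ k, ∀ᶠ n in atTop, Q k n (x n) := by
  classical
  have hstep : ∀ n, ∃ x, P n x ∧ ∀ k ≤ n, (∃ x', P n x' ∧ Q k n x') → Q k n x := by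
    intro n
    -- At each `n` the strongest satisfiable level `k ≤ n` is taken; the cap keeps the search finite
    -- and disappears as `n` grows.
    let T := (Finset.range (n + 1)).filter fun k => ∃ x', P n x' ∧ Q k n x'
    by_cases hT : T.Nonempty
    · obtain ⟨x, hx, hxQ⟩ := (Finset.mem_filter.1 (T.max'_mem hT)).2
      refine ⟨x, hx, fun k hk hex => hQ n x (T.le_max' k ?_) hxQ⟩
      exact Finset.mem_filter.2 ⟨Finset.mem_range.2 (by omega), hex⟩
    · obtain ⟨x, hx⟩ := hP n
      refine ⟨x, hx, fun k hk hex => absurd ⟨k, ?_⟩ hT⟩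
      exact Finset.mem_filter.2 ⟨Finset.mem_range.2 (by omega), hex⟩
  choose x hx hxQ using hstep
  refine ⟨x, hx, fun k => ?_⟩
  filter_upwards [H k, eventually_ge_atTop k] with n hn hkn
  exact hxQ n k hkn hn

section Sources

variable {𝒳 𝒴 : Type*} [Fintype 𝒳] [MeasurableSpace 𝒴] {W : GeneralChannel 𝒳 𝒴}

/-- The input distribution `μ` has, up to `1 / (k + 1)`, entropy rate at least `h` and conditional
entropy rate at most `g`. -/
def HasRates (W : GeneralChannel 𝒳 𝒴) (h g : ℝ) (k n : ℕ) (μ : PMF (Fin n → 𝒳)) : Prop :=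
  likelyMass μ (expRate n (-(h - 1 / ((k : ℝ) + 1)))) ≤ 1 / ((k : ℝ) + 1) ∧
  smallPost μ (W n) (expRate n (-(g + 1 / ((k : ℝ) + 1)))) ≤ 1 / ((k : ℝ) + 1)

lemma hasRates_antitone (h g : ℝ) (n : ℕ) (μ : PMF (Fin n → 𝒳)) :
    Antitone fun k => HasRates W h g k n μ := by
  intro k l hkl hl
  have hle : 1 / ((l : ℝ) + 1) ≤ 1 / ((k : ℝ) + 1) := Nat.one_div_le_one_div hkl
  exact ⟨(likelyMass_anti _ (expRate_mono n (by linarith))).trans (hl.1.trans hle),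
    (smallPost_mono _ _ (expRate_mono n (by linarith))).trans (hl.2.trans hle)⟩

/-- The distributions of different block lengths can be chosen independently, so approximate rates
at every accuracy yield one source with the exact bounds. -/
lemma exists_source_of_hasRates {P : InputConstraint 𝒳} (hP : ∀ n, (P n).Nonempty) {h g : ℝ}
    (H : ∀ k, ∀ᶠ n in atTop, ∃ μ ∈ P n, HasRates W h g k n μ) :
    ∃ X : GeneralSource 𝒳, (∀ n, X n ∈ P n) ∧ h - g ≤ entropyGap X W := by
  obtain ⟨X, hX, hXQ⟩ := exists_diagonal (S := fun n => PMF (Fin n → 𝒳))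
    (P := fun n μ => μ ∈ P n) (Q := HasRates W h g) hP (hasRates_antitone h g) H
  refine ⟨X, hX, sub_le_sub (le_infEntropyRate fun θ hθ => ?_)
    (condSupEntropyRate_le fun θ hθ => ?_)⟩
  · rw [Metric.tendsto_nhds]
    intro ε hε
    obtain ⟨k, hk⟩ := exists_nat_one_div_lt (lt_min hε (sub_pos.2 hθ))
    filter_upwards [hXQ k] with n hn
    rw [Real.dist_0_eq_abs, abs_of_nonneg (likelyMass_nonneg _ _)]
    refine lt_of_le_of_lt ((likelyMass_anti _ (expRate_mono n ?_)).trans hn.1)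
      (hk.trans_le (min_le_left _ _))
    linarith [hk.trans_le (min_le_right _ _)]
  · rw [Metric.tendsto_nhds]
    intro ε hε
    obtain ⟨k, hk⟩ := exists_nat_one_div_lt (lt_min hε (sub_pos.2 hθ))
    filter_upwards [hXQ k] with n hn
    rw [Real.dist_0_eq_abs, abs_of_nonneg (smallPost_nonneg _ _ _)]
    refine lt_of_le_of_lt ((smallPost_mono _ _ (expRate_mono n ?_)).trans hn.2)
      (hk.trans_le (min_le_left _ _))
    linarith [hk.trans_le (min_le_right _ _)]

/-- The supremum in the capacity formula is attained. -/
theorem exists_maximal_entropyGap (W : GeneralChannel 𝒳 𝒴) {P : InputConstraint 𝒳}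
    (hP : ∀ n, (P n).Nonempty) :
    ∃ X : GeneralSource 𝒳, (∀ n, X n ∈ P n) ∧
      ∀ X' : GeneralSource 𝒳, (∀ n, X' n ∈ P n) → entropyGap X' W ≤ entropyGap X W := by
  let L := Real.logb 2 (Fintype.card 𝒳)
  let D : Set (ℝ × ℝ) := {p | ∃ X : GeneralSource 𝒳, (∀ n, X n ∈ P n) ∧
    p = (infEntropyRate X, condSupEntropyRate X W)}
  have hD : D ⊆ Set.Icc 0 L ×ˢ Set.Icc 0 L := by
    rintro _ ⟨X, -, rfl⟩
    exact ⟨⟨infEntropyRate_nonneg, infEntropyRate_le⟩,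
      ⟨condSupEntropyRate_nonneg, condSupEntropyRate_le_logb⟩⟩
  -- The maximizing pair lies only in the closure of `D`. Sources with rates within `1 / (k + 1)` of
  -- it supply the distributions to splice.
  have hcomp : IsCompact (closure D) :=
    (isCompact_Icc.prod isCompact_Icc).of_isClosed_subset isClosed_closure
      (closure_minimal hD (isClosed_Icc.prod isClosed_Icc))
  choose X₀ hX₀ using hP
  have hne : (closure D).Nonempty := ⟨_, subset_closure ⟨X₀, hX₀, rfl⟩⟩
  obtain ⟨⟨h, g⟩, hmem, hmax⟩ := hcomp.exists_isMaxOn hne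
    (f := fun p : ℝ × ℝ => p.1 - p.2) (by fun_prop)
  have H : ∀ k, ∀ᶠ n in atTop, ∃ μ ∈ P n, HasRates W h g k n μ := by
    intro k
    have hk : (0 : ℝ) < 1 / ((k : ℝ) + 1) := Nat.one_div_pos_of_nat
    obtain ⟨_, ⟨X, hX, rfl⟩, hd⟩ := Metric.mem_closure_iff.1 hmem _ hk
    rw [Prod.dist_eq, max_lt_iff, Real.dist_eq, Real.dist_eq, abs_lt, abs_lt] at hd
    filter_upwards [(tendsto_likelyMass (X := X) (θ := h - 1 / ((k : ℝ) + 1))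
        (by linarith [hd.1.2])).eventually_le_const hk,
      (tendsto_smallPost (X := X) (W := W) (θ := g + 1 / ((k : ℝ) + 1))
        (by linarith [hd.2.1])).eventually_le_const hk] with n h1 h2
    exact ⟨X n, hX n, h1, h2⟩
  obtain ⟨X, hX, hgap⟩ := exists_source_of_hasRates (fun n => ⟨X₀ n, hX₀ n⟩) H
  exact ⟨X, hX, fun X' hX' => le_trans (hmax (subset_closure ⟨X', hX', rfl⟩)) hgap⟩

end Sources

/-! ### Converse: the channel input of a reliable code -/

section Converse

variable {V O : Type*} [MeasurableSpace O] {M : ℕ} [NeZero M]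

open Classical in
lemma map_uniform_toReal (φ : Fin M → V) (x : V) :
    ((PMF.uniformOfFintype (Fin M)).map φ x).toReal =
      ((Finset.univ.filter fun m => φ m = x).card : ℝ) / M := by
  rw [PMF.map_apply, tsum_fintype, ENNReal.toReal_sum]
  · simp only [PMF.uniformOfFintype_apply, Fintype.card_fin]
    rw [← Finset.sum_filter_add_sum_filter_not Finset.univ (fun m => φ m = x),
      Finset.sum_congr (g := fun _ => (M : ℝ)⁻¹) rfl, Finset.sum_const, Finset.sum_eq_zero]
    · simp [div_eq_mul_inv]
    · intro m hm
      rw [if_neg fun h => (Finset.mem_filter.1 hm).2 h.symm]; simp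
    · intro m hm
      rw [if_pos (Finset.mem_filter.1 hm).2.symm]; simp
  · intro m _
    split_ifs <;> simp [NeZero.ne M]

lemma sum_map_uniform_mul [Fintype V] (φ : Fin M → V) (f : V → ℝ) :
    ∑ x, ((PMF.uniformOfFintype (Fin M)).map φ x).toReal * f x =
      ∑ m, 1 / (M : ℝ) * f (φ m) := by
  classical
  rw [← Finset.sum_fiberwise_of_maps_to (s := Finset.univ) (t := Finset.univ) (g := φ)
    (fun _ _ => Finset.mem_univ _)]
  refine Finset.sum_congr rfl fun x _ => ?_
  rw [map_uniform_toReal, Finset.sum_congr (g := fun _ => 1 / (M : ℝ) * f x) rfl]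
  · rw [Finset.sum_const, nsmul_eq_mul]; ring
  · intro m hm
    rw [(Finset.mem_filter.1 hm).2]

variable [Fintype V] (W : V → ProbabilityMeasure O) (φ : Fin M → V) {ψ : O → Fin M}

/-- The average error probability of a channel code. -/
noncomputable def avgError (ψ : O → Fin M) : ℝ :=
  ∑ m, 1 / (M : ℝ) * (W (φ m) : Measure O).real {y | ψ y ≠ m}

/-- Re-encoding the decoded message, `φ ∘ ψ`, estimates the channel input. -/
lemma smallPost_map_uniform_le (hψ : Measurable ψ) {t : ℝ} (ht : 0 ≤ t) :
    smallPost ((PMF.uniformOfFintype (Fin M)).map φ) W t ≤ avgError W φ ψ + t := by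
  refine (smallPost_le_of_estimator _ W ht (fun y => φ (ψ y)) fun x =>
    hψ (MeasurableSet.of_discrete (s := φ ⁻¹' {x}))).trans (add_le_add ?_ le_rfl)
  simp only [joint_real]
  rw [sum_map_uniform_mul φ fun x => (W x : Measure O).real {y | φ (ψ y) ≠ x}]
  refine Finset.sum_le_sum fun m _ => mul_le_mul_of_nonneg_left (measureReal_mono ?_) (by positivity)
  intro y hy h
  exact hy (congrArg φ h)

open Classical in
-- A codeword more likely than `1 / M` is shared by `k ≥ 2` messages. Their correct-decoding
-- probabilities sum to at most one, so they contribute at least `(k - 1) / M ≥ k / (2 M)` to the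
-- error.
lemma likelyMass_map_uniform_le (hψ : Measurable ψ) {u : ℝ} (hu : 1 / (M : ℝ) ≤ u) :
    likelyMass ((PMF.uniformOfFintype (Fin M)).map φ) u ≤ 2 * avgError W φ ψ := by
  have hM : (0 : ℝ) < M := by exact_mod_cast Nat.pos_of_ne_zero (NeZero.ne M)
  rw [avgError, ← Finset.sum_fiberwise_of_maps_to (s := Finset.univ) (t := Finset.univ) (g := φ)
    (fun _ _ => Finset.mem_univ _), Finset.mul_sum, likelyMass, Finset.sum_filter]
  refine Finset.sum_le_sum fun x _ => ?_
  rw [map_uniform_toReal]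
  set F := Finset.univ.filter fun m => φ m = x with hF
  split_ifs with h
  · have h2 : (2 : ℝ) ≤ F.card := by
      have h1 := hu.trans_lt h
      rw [div_lt_div_iff_of_pos_right hM] at h1
      exact_mod_cast h1
    have hsum : ∑ m ∈ F, 1 / (M : ℝ) * (W (φ m) : Measure O).real {y | ψ y ≠ m} =
        1 / (M : ℝ) * ((F.card : ℝ) - ∑ m ∈ F, (W x : Measure O).real (ψ ⁻¹' {m})) := by
      rw [← Finset.mul_sum]
      congr 1
      rw [Finset.card_eq_sum_ones, Nat.cast_sum, ← Finset.sum_sub_distrib]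
      refine Finset.sum_congr rfl fun m hm => ?_
      rw [(Finset.mem_filter.1 hm).2]
      have := probReal_compl_eq_one_sub (μ := (W x : Measure O)) (hψ (measurableSet_singleton m))
      rw [Nat.cast_one, ← this]
      rfl
    have hle : ∑ m ∈ F, (W x : Measure O).real (ψ ⁻¹' {m}) ≤ 1 := by
      rw [sum_measureReal_preimage_singleton _ fun m _ => hψ (measurableSet_singleton m)]
      exact measureReal_le_one
    rw [hsum, div_eq_mul_one_div, mul_comm, mul_left_comm]
    exact mul_le_mul_of_nonneg_left (by linarith) (by positivity)
  · exact mul_nonneg two_pos.le (Finset.sum_nonneg fun _ _ => by positivity)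

end Converse

section Capacity

variable {𝒳 𝒴 : Type*} [Fintype 𝒳] [MeasurableSpace 𝒴] {W : GeneralChannel 𝒳 𝒴}

/-- Every achievable rate is at most the entropy gap of some admissible source. -/
lemma IsAchievable.exists_le_entropyGap {P : InputConstraint 𝒳} (hP : ∀ n, (P n).Nonempty)
    {R : ℝ} (hR : IsAchievable W P R) :
    ∃ X : GeneralSource 𝒳, (∀ n, X n ∈ P n) ∧ R ≤ entropyGap X W := by
  -- The conditional rate is `0`: the codeword is asymptotically determined by the output.
  suffices H : ∀ k, ∀ᶠ n in atTop, ∃ μ ∈ P n, HasRates W R 0 k n μ by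
    simpa using exists_source_of_hasRates hP H
  intro k
  have hk : (0 : ℝ) < 1 / ((k : ℝ) + 1) := Nat.one_div_pos_of_nat
  set ε := 1 / ((k : ℝ) + 1) with hε
  filter_upwards [hR (ε / 2) (by linarith), eventually_gt_atTop 0,
    (tendsto_expRate (a := -(0 + ε)) (by linarith)).eventually_le_const
      (show 0 < ε / 2 by linarith)] with n ⟨M, hM, φ, ψ, hψ, hRM, hmem, herr⟩ hn hexp
  have hM0 : (0 : ℝ) < M := by exact_mod_cast Nat.pos_of_ne_zero (NeZero.ne M)
  refine ⟨_, hmem, ?_, ?_⟩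
  · refine (likelyMass_map_uniform_le (W n) φ hψ ?_).trans (le_trans
      (mul_le_mul_of_nonneg_left herr two_pos.le) (by linarith))
    have h1 : expRate n R ≤ M := by
      by_contra! hlt
      exact absurd ((normalized_logb_lt_iff hn hM0).2 hlt) (not_lt.2 hRM)
    calc 1 / (M : ℝ) ≤ (expRate n R)⁻¹ := by
          rw [one_div]; exact inv_anti₀ (expRate_pos n R) h1
      _ = expRate n (-R) := (expRate_neg n R).symm
      _ ≤ _ := expRate_mono n (by linarith)
  · refine (smallPost_map_uniform_le (W n) φ hψ (expRate_pos _ _).le).trans ?_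
    have : avgError (W n) φ ψ ≤ ε / 2 := herr
    linarith

lemma channelCapacity_le {P : InputConstraint 𝒳} (hP : ∀ n, (P n).Nonempty)
    {X : GeneralSource 𝒳} (hmax : ∀ X' : GeneralSource 𝒳, (∀ n, X' n ∈ P n) →
      entropyGap X' W ≤ entropyGap X W) :
    channelCapacity W P ≤ (entropyGap X W : EReal) := by
  refine sSup_le ?_
  rintro _ ⟨R, hR, rfl⟩
  obtain ⟨X', hX', hle⟩ := IsAchievable.exists_le_entropyGap hP hR
  exact EReal.coe_le_coe_iff.2 (hle.trans (hmax X' hX'))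

end Capacity

/-! ### Uniform random binning -/

section Binning

variable {V : Type*} [Fintype V]

open Classical in
/-- The uniform distribution on all functions from `V` to `{0, …, M - 1}`. -/
noncomputable def uniformBinning (V : Type*) [Fintype V] (M : ℕ) [NeZero M] :
    FunctionEnsemble V ℕ where
  carrier := Fintype.piFinset fun _ => Finset.range M
  prob _ := 1 / ((Fintype.piFinset fun _ : V => Finset.range M).card : ℝ)
  prob_nonneg _ _ := by positivity
  sum_prob := by
    rw [Finset.sum_const, nsmul_eq_mul, mul_one_div_cancel]
    simp [NeZero.ne M]

lemma uniformBinning_im [Nonempty V] (M : ℕ) [NeZero M] :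
    (uniformBinning V M).im = Finset.range M := by
  classical
  ext c
  simp only [FunctionEnsemble.im, Finset.mem_biUnion, Finset.mem_image, Finset.mem_univ, true_and,
    uniformBinning, Fintype.mem_piFinset]
  constructor
  · rintro ⟨A, hA, x, rfl⟩
    exact hA x
  · intro hc
    exact ⟨fun _ => c, fun _ => hc, Classical.arbitrary V, rfl⟩

lemma uniformBinning_collisionProb_le (M : ℕ) [NeZero M] {x x' : V} (h : x' ≠ x) :
    (uniformBinning V M).collisionProb x x' ≤ 1 / (M : ℝ) := by
  classical
  have hM : (0 : ℝ) < M := by exact_mod_cast Nat.pos_of_ne_zero (NeZero.ne M)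
  set F := Fintype.piFinset fun _ : V => Finset.range M with hF
  have hcard : (F.filter fun A => A x = A x').card * M ≤ F.card := by
    rw [← Finset.card_range M, ← Finset.card_product]
    -- Overwriting the value at `x` loses nothing: a colliding `A` has `A x = A x'`, and `A x'` is
    -- untouched.
    refine Finset.card_le_card_of_injOn (fun p => Function.update p.1 x p.2) ?_ ?_
    · rintro ⟨A, j⟩ hp
      simp only [Finset.coe_product, Set.mem_prod, Finset.mem_coe, Finset.mem_filter, hF,
        Fintype.mem_piFinset] at hp ⊢
      intro z
      by_cases hz : z = x
      · subst hz; simpa using hp.2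
      · simpa [hz] using hp.1.1 z
    · rintro ⟨A, j⟩ hp ⟨A', j'⟩ hp' heq
      simp only [Finset.coe_product, Set.mem_prod, Finset.mem_coe, Finset.mem_filter] at hp hp' heq
      have hj : j = j' := by simpa using congrFun heq x
      have hA : ∀ z, z ≠ x → A z = A' z := fun z hz => by simpa [hz] using congrFun heq z
      refine Prod.ext (funext fun z => ?_) hj
      by_cases hz : z = x
      · subst hz
        exact hp.1.2.trans ((hA x' h).trans hp'.1.2.symm)
      · exact hA z hz
  have hF0 : (0 : ℝ) < F.card := by
    have : F.card ≠ 0 := by simp [hF, NeZero.ne M]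
    exact_mod_cast Nat.pos_of_ne_zero this
  have heq : (uniformBinning V M).collisionProb x x' =
      ((F.filter fun A => A x = A x').card : ℝ) * (1 / (F.card : ℝ)) := by
    simp only [FunctionEnsemble.collisionProb, uniformBinning]
    rw [Finset.sum_const, nsmul_eq_mul]
    congr!
  rw [heq, mul_one_div, div_le_div_iff₀ hF0 hM, one_mul]
  exact_mod_cast hcard

/-- No pair strictly exceeds the threshold `1 / M`, so the sum is empty. The same ensemble therefore
serves as both `𝒜` and `ℬ`. -/
lemma uniformBinning_hashBound (M : ℕ) [NeZero M] : (uniformBinning V M).HashBound 1 0 := by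
  classical
  intro x
  have : Nonempty V := ⟨x⟩
  rw [Finset.sum_eq_zero]
  intro x' hx'
  obtain ⟨-, hne, hlt⟩ := Finset.mem_filter.1 hx'
  rw [uniformBinning_im, Finset.card_range] at hlt
  exact absurd (uniformBinning_collisionProb_le M hne) (not_le.2 hlt)

variable {𝒳 : Type*} [Fintype 𝒳]

lemma uniformBinning_collisionResistance (M : ℕ → ℕ) [∀ n, NeZero (M n)] :
    CollisionResistance (fun n => uniformBinning (Fin n → 𝒳) (M n)) (fun _ => 1) (fun _ => 0) where
  limsup_alpha := by simp [normalizedLog]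
  limsup_beta := by simp
  hash := Eventually.of_forall fun n => uniformBinning_hashBound (M n)

lemma uniformBinning_balancedColoring (M : ℕ → ℕ) [∀ n, NeZero (M n)] :
    BalancedColoring (fun n => uniformBinning (Fin n → 𝒳) (M n)) (fun _ => 1) (fun _ => 0) where
  limsup_alpha := by simp
  limsup_beta := by simp [normalizedLog]
  hash := Eventually.of_forall fun n => uniformBinning_hashBound (M n)

/-- The number `⌈2 ^ (n r)⌉` of bins of rate `r`. -/
noncomputable def binCount (r : ℝ) (n : ℕ) : ℕ := ⌈expRate n r⌉₊

instance (r : ℝ) (n : ℕ) : NeZero (binCount r n) :=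
  ⟨(Nat.ceil_pos.2 (expRate_pos n r)).ne'⟩

lemma tendsto_rate_uniformBinning [Nonempty 𝒳] {r : ℝ} (hr : 0 ≤ r) :
    Tendsto (fun n => ensembleRate n (uniformBinning (Fin n → 𝒳) (binCount r n))) atTop (𝓝 r) := by
  simp only [ensembleRate, uniformBinning_im, Finset.card_range]
  have hup : Tendsto (fun n : ℕ => r + 1 / (n : ℝ)) atTop (𝓝 r) := by
    simpa using tendsto_one_div_atTop_nhds_zero_nat.const_add r
  have hlog : ∀ n : ℕ, Real.logb 2 (expRate n r) = n * r := fun n => by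
    rw [expRate, Real.logb_rpow two_pos (by norm_num)]
  refine tendsto_of_tendsto_of_tendsto_of_le_of_le' tendsto_const_nhds hup ?_ ?_
  · filter_upwards [eventually_gt_atTop 0] with n hn
    have hn' : (0 : ℝ) < n := by exact_mod_cast hn
    have h1 := Real.logb_le_logb_of_le one_lt_two (expRate_pos n r)
      (Nat.le_ceil (expRate n r))
    rw [hlog] at h1
    rw [one_div, le_inv_mul_iff₀ hn']
    exact h1
  · filter_upwards [eventually_gt_atTop 0] with n hn
    have hn' : (0 : ℝ) < n := by exact_mod_cast hn
    -- Since `2 ^ (n r) ≥ 1`, rounding up at most doubles the count and adds at most `1 / n` to the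
    -- rate.
    have h1 : ((binCount r n : ℕ) : ℝ) ≤ 2 * expRate n r := by
      have := (Nat.ceil_lt_add_one (expRate_pos n r).le).le
      have h2 := one_le_expRate n hr
      rw [binCount]
      linarith
    have h2 := Real.logb_le_logb_of_le one_lt_two
      (by exact_mod_cast Nat.pos_of_ne_zero (NeZero.ne (binCount r n))) h1
    rw [Real.logb_mul two_ne_zero (expRate_pos n r).ne', hlog,
      Real.logb_self_eq_one one_lt_two] at h2
    rw [one_div, inv_mul_le_iff₀ hn', mul_add, mul_inv_cancel₀ hn'.ne']
    linarith

end Binning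

/-! ### Measurable decoders and deterministic encoders -/

section Decoder

variable {V O K L : Type*} [MeasurableSpace O]

/-- A measurable choice of a maximizer over a finite set. -/
lemma exists_measurable_argmax {g : V → O → ℝ} (hg : ∀ x, Measurable (g x)) {S : Finset V}
    (hS : S.Nonempty) : ∃ d : O → V, (∀ T : Set V, MeasurableSet (d ⁻¹' T)) ∧
      ∀ y, d y ∈ S ∧ ∀ x ∈ S, g x y ≤ g (d y) y := by
  -- Measurability of the running maximum is added to the induction, since the next comparison uses
  -- it.
  suffices H : ∃ d : O → V, (∀ T : Set V, MeasurableSet (d ⁻¹' T)) ∧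
      (Measurable fun y => g (d y) y) ∧ ∀ y, d y ∈ S ∧ ∀ x ∈ S, g x y ≤ g (d y) y by
    obtain ⟨d, h1, -, h2⟩ := H
    exact ⟨d, h1, h2⟩
  classical
  induction hS using Finset.Nonempty.cons_induction with
  | singleton a =>
    exact ⟨fun _ => a, fun T => MeasurableSet.const (a ∈ T), hg a, fun y => by simp⟩
  | cons a s ha hs ih =>
    obtain ⟨d, hd, hgd, hmax⟩ := ih
    have hle : MeasurableSet {y | g (d y) y ≤ g a y} := measurableSet_le hgd (hg a)
    refine ⟨fun y => if g (d y) y ≤ g a y then a else d y, fun T => ?_, ?_, fun y => ?_⟩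
    · let _ : MeasurableSpace V := ⊤
      have h1 : Measurable fun y => if g (d y) y ≤ g a y then a else d y :=
        Measurable.ite hle measurable_const fun T _ => hd T
      exact h1 (t := T) trivial
    · have : (fun y => g (if g (d y) y ≤ g a y then a else d y) y) =
          fun y => if g (d y) y ≤ g a y then g a y else g (d y) y := by
        funext y; split_ifs <;> rfl
      rw [this]
      exact Measurable.ite hle (hg a) hgd
    · obtain ⟨h1, h2⟩ := hmax y
      beta_reduce
      split_ifs with h
      · refine ⟨Finset.mem_cons_self a s, fun x hx => ?_⟩
        rcases Finset.mem_cons.1 hx with rfl | hx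
        · exact le_rfl
        · exact (h2 x hx).trans h
      · refine ⟨Finset.mem_cons.2 (Or.inr h1), fun x hx => ?_⟩
        rcases Finset.mem_cons.1 hx with rfl | hx
        · exact (not_le.1 h).le
        · exact h2 x hx

variable [Fintype V]

/-- The reliability theorem accepts any maximizing decoder, but an operational code needs a
measurable one. -/
lemma exists_measurable_maximizesPost (μ : PMF V) (W : V → ProbabilityMeasure O) (A : V → K) :
    ∃ dec : K → O → V, (∀ c (T : Set V), MeasurableSet (dec c ⁻¹' T)) ∧
      MaximizesPost μ W A dec := by
  classical
  have hstep : ∀ c, ∃ d : O → V, (∀ T : Set V, MeasurableSet (d ⁻¹' T)) ∧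
      (c ∈ Set.range A → ∀ y, A (d y) = c ∧ ∀ x, A x = c → post μ W x y ≤ post μ W (d y) y) := by
    intro c
    by_cases hc : c ∈ Set.range A
    · obtain ⟨x, hx⟩ := hc
      obtain ⟨d, hd, hmax⟩ := exists_measurable_argmax (measurable_post μ W)
        (S := Finset.univ.filter fun x => A x = c) ⟨x, by simp [hx]⟩
      exact ⟨d, hd, fun _ y => by simpa using hmax y⟩
    · exact ⟨fun _ => μ.support_nonempty.some, fun T => MeasurableSet.const (_ ∈ T),
        fun h => absurd h hc⟩
  choose dec hdec hmax using hstep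
  exact ⟨dec, hdec, fun c hc y => (hmax c hc y).1, fun c hc => ae_of_all _ fun y => (hmax c hc y).2⟩

lemma sum_encoderLaw {μ : PMF V} {A : V → K} {B : V → L} {c : K} {m : L}
    (h : constrainedMass μ A B c m ≠ 0) : ∑ x, encoderLaw μ A B c m x = 1 := by
  classical
  simp only [encoderLaw]
  rw [← Finset.sum_filter, ← Finset.sum_div, div_eq_one_iff_eq h, constrainedMass]
  exact Finset.sum_congr (by simp) fun _ _ => rfl

lemma encoderLaw_nonneg (μ : PMF V) (A : V → K) (B : V → L) (c : K) (m : L) (x : V) :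
    0 ≤ encoderLaw μ A B c m x := by
  unfold encoderLaw
  split_ifs
  · exact div_nonneg ENNReal.toReal_nonneg
      (Finset.sum_nonneg fun _ _ => ENNReal.toReal_nonneg)
  · exact le_rfl

open Classical in
/-- The stochastic encoder can be replaced by a deterministic one. -/
lemma exists_deterministic_code (μ : PMF V) (W : V → ProbabilityMeasure O) (msgs : Finset L)
    [NeZero msgs.card] (A : V → K) {B : V → L} (hB : ∀ x, B x ∈ msgs) (c : K)
    {dec : K → O → V} (hdec : ∀ T : Set V, MeasurableSet (dec c ⁻¹' T)) :
    ∃ (φ : Fin msgs.card → V) (ψ : O → Fin msgs.card), Measurable ψ ∧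
      avgError W φ ψ ≤ codeError μ W msgs A B c dec := by
  let err : L → V → ℝ := fun m x => (W x : Measure O).real {y | channelDecoder B dec c y ≠ m}
  -- The best input for `m` does no worse than the encoder's average, and no worse than a declared
  -- failure. It need not satisfy `A x = c` or `B x = m`.
  have hbest : ∀ m : L, ∃ x, 1 / (msgs.card : ℝ) * err m x ≤
      (if constrainedMass μ A B c m = 0 then 1 / (msgs.card : ℝ) else 0) +
      (if 0 < constrainedMass μ A B c m then
        ∑ x : V, 1 / (msgs.card : ℝ) * encoderLaw μ A B c m x * err m x else 0) := by
    intro m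
    have : Nonempty V := ⟨μ.support_nonempty.some⟩
    obtain ⟨x₀, -, hx₀⟩ := Finset.exists_min_image Finset.univ (err m) Finset.univ_nonempty
    refine ⟨x₀, ?_⟩
    by_cases hm : constrainedMass μ A B c m = 0
    · simp only [hm, if_true, lt_irrefl, if_false, add_zero]
      exact mul_le_of_le_one_right (by positivity) measureReal_le_one
    · have hpos : 0 < constrainedMass μ A B c m :=
        lt_of_le_of_ne (Finset.sum_nonneg fun _ _ => ENNReal.toReal_nonneg) (Ne.symm hm)
      rw [if_neg hm, if_pos hpos, zero_add]
      calc 1 / (msgs.card : ℝ) * err m x₀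
          = ∑ x : V, 1 / (msgs.card : ℝ) * encoderLaw μ A B c m x * err m x₀ := by
            rw [← Finset.sum_mul, ← Finset.mul_sum, sum_encoderLaw hm, mul_one]
        _ ≤ _ := Finset.sum_le_sum fun x _ => mul_le_mul_of_nonneg_left
            (hx₀ x (Finset.mem_univ x)) (mul_nonneg (by positivity) (encoderLaw_nonneg _ _ _ _ _ _))
  choose best hbest using hbest
  let e := msgs.equivFin
  refine ⟨fun m => best (e.symm m), fun y => e ⟨B (dec c y), hB _⟩, ?_, ?_⟩
  · intro T _
    exact hdec ((fun x => e ⟨B x, hB x⟩) ⁻¹' T)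
  · rw [codeError, Finset.sum_filter, Finset.sum_filter, ← Finset.sum_add_distrib,
      ← Finset.sum_coe_sort msgs, ← e.symm.sum_comp, avgError]
    refine Finset.sum_le_sum fun m _ => le_trans (le_of_eq ?_) (hbest (e.symm m))
    have : {y | e ⟨B (dec c y), hB _⟩ ≠ m} =
        {y | channelDecoder B dec c y ≠ (e.symm m : L)} := by
      ext y
      refine not_congr ?_
      rw [← e.eq_symm_apply, Subtype.ext_iff]
      rfl
    rw [this]

end Decoder

/-! ### Direct part of the capacity formula -/

section DirectPart

lemma isAchievable_noConstraint_of_nonpos {𝒳 𝒴 : Type*} [MeasurableSpace 𝒴] [Nonempty 𝒳]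
    (W : GeneralChannel 𝒳 𝒴) {ρ : ℝ} (hρ : ρ ≤ 0) : IsAchievable W (noConstraint 𝒳) ρ := by
  intro δ hδ
  refine Eventually.of_forall fun n => ⟨1, inferInstance, fun _ _ => Classical.arbitrary 𝒳,
    fun _ => 0, measurable_const, by simpa using hρ, trivial, ?_⟩
  have : ∀ m : Fin 1, {y : Fin n → 𝒴 | (0 : Fin 1) ≠ m} = ∅ := fun m => by
    ext y; simp [Subsingleton.elim m 0]
  simpa [this] using hδ.le

variable {𝒳 𝒴 : Type*} [Fintype 𝒳] [MeasurableSpace 𝒴] {W : GeneralChannel 𝒳 𝒴}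

/-- Ensembles with which the code approaches the entropy gap of a source. -/
lemma exists_ensembles {X : GeneralSource 𝒳} (hpos : 0 < entropyGap X W) {ε : ℝ} (hε : 0 < ε) :
    ∃ (𝒜 ℬ : (n : ℕ) → FunctionEnsemble (Fin n → 𝒳) ℕ) (αA βA αB βB : ℕ → ℝ) (r R : ℝ),
      CollisionResistance 𝒜 αA βA ∧ BalancedColoring ℬ αB βB ∧
      Tendsto (fun n => ensembleRate n (𝒜 n)) atTop (𝓝 r) ∧
      Tendsto (fun n => ensembleRate n (ℬ n)) atTop (𝓝 R) ∧
      condSupEntropyRate X W < r ∧ r + R < infEntropyRate X ∧ entropyGap X W - ε < R := by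
  have := GeneralSource.nonempty X
  -- With `r` exceeding the conditional rate by `η / 2` and `R` equal to the gap minus `η`, `r + R`
  -- stays `η / 2` below the entropy rate, while `R` is positive.
  set η := min ε (entropyGap X W) / 2 with hη
  have hη0 : 0 < η := half_pos (lt_min hε hpos)
  have hη1 : η ≤ ε / 2 := by rw [hη]; linarith [min_le_left ε (entropyGap X W)]
  have hη2 : η ≤ entropyGap X W / 2 := by rw [hη]; linarith [min_le_right ε (entropyGap X W)]
  have hg : entropyGap X W = infEntropyRate X - condSupEntropyRate X W := rfl
  have hc : 0 ≤ condSupEntropyRate X W := condSupEntropyRate_nonneg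
  exact ⟨_, _, _, _, _, _, condSupEntropyRate X W + η / 2, entropyGap X W - η,
    uniformBinning_collisionResistance (binCount _), uniformBinning_balancedColoring (binCount _),
    tendsto_rate_uniformBinning (by linarith), tendsto_rate_uniformBinning (by linarith),
    by linarith, by linarith, by linarith⟩

lemma isAchievable_noConstraint_of_lt_entropyGap {X : GeneralSource 𝒳} {ρ : ℝ}
    (hρ : ρ < entropyGap X W) : IsAchievable W (noConstraint 𝒳) ρ := by
  have := GeneralSource.nonempty X
  rcases le_or_gt ρ 0 with h0 | h0
  · exact isAchievable_noConstraint_of_nonpos W h0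
  obtain ⟨𝒜, ℬ, αA, βA, αB, βB, r, R, hA, hB, hr, hR, h1, h2, h3⟩ :=
    exists_ensembles (h0.trans hρ) (sub_pos.2 hρ)
  rw [sub_sub_cancel] at h3
  choose dec hmeas hmax using fun n => exists_measurable_maximizesPost (K := ℕ) (X n) (W n)
  intro δ hδ
  filter_upwards [eventually_exists_codeError_lt hA hB hr hR h1 h2 dec
    (fun n A _ => hmax n A) hδ, hR.eventually_const_lt h3]
    with n ⟨A, _, B, hBc, c, _, herr⟩ hrate
  have : NeZero (ℬ n).im.card :=
    ⟨(Nat.cast_pos.1 (im_card_pos_of_source X (ℬ n))).ne'⟩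
  obtain ⟨φ, ψ, hψ, hle⟩ := exists_deterministic_code (X n) (W n) (ℬ n).im A
    ((ℬ n).apply_mem_im hBc) c (hmeas n A c)
  exact ⟨(ℬ n).im.card, this, φ, ψ, hψ, hrate.le, trivial, hle.trans herr.le⟩

lemma entropyGap_le_channelCapacity (X : GeneralSource 𝒳) :
    (entropyGap X W : EReal) ≤ channelCapacity W (noConstraint 𝒳) := by
  by_contra! hlt
  obtain ⟨ρ, h1, h2⟩ := EReal.lt_iff_exists_real_btwn.1 hlt
  refine absurd h1 (not_lt.2 (le_sSup ⟨ρ, ?_, rfl⟩))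
  exact isAchievable_noConstraint_of_lt_entropyGap (EReal.coe_lt_coe_iff.1 h2)

end DirectPart

end ChannelCRNG

theorem corollary1 {𝒳 𝒴 : Type*} [Fintype 𝒳] [MeasurableSpace 𝒴]
    (W : ChannelCRNG.GeneralChannel 𝒳 𝒴) :
    -- reliability of the code for all ensembles with the two properties
    (∀ (X : ChannelCRNG.GeneralSource 𝒳) (K L : ℕ → Type*)
        (𝒜 : (n : ℕ) → ChannelCRNG.FunctionEnsemble (Fin n → 𝒳) (K n))
        (ℬ : (n : ℕ) → ChannelCRNG.FunctionEnsemble (Fin n → 𝒳) (L n))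
        (αA βA αB βB : ℕ → ℝ) (r R : ℝ),
        ChannelCRNG.CollisionResistance 𝒜 αA βA →
        ChannelCRNG.BalancedColoring ℬ αB βB →
        Tendsto (fun n => ChannelCRNG.ensembleRate n (𝒜 n)) atTop (𝓝 r) →
        Tendsto (fun n => ChannelCRNG.ensembleRate n (ℬ n)) atTop (𝓝 R) →
        ChannelCRNG.condSupEntropyRate X W < r →
        r + R < ChannelCRNG.infEntropyRate X →
        ∀ dec : (n : ℕ) → ((Fin n → 𝒳) → K n) → K n → (Fin n → 𝒴) → (Fin n → 𝒳),
        (∀ n, ∀ A ∈ (𝒜 n).carrier, ChannelCRNG.IsMAPDecoder X W n A (dec n A)) →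
        ∀ δ : ℝ, 0 < δ → ∀ᶠ n : ℕ in atTop,
          ∃ A ∈ (𝒜 n).carrier, ∃ B ∈ (ℬ n).carrier, ∃ c ∈ (𝒜 n).im,
            ChannelCRNG.codeError (X n) (W n) (ℬ n).im A B c (dec n A) < δ) ∧
    -- the supremum in the capacity formula is attained
    (∀ P : ChannelCRNG.InputConstraint 𝒳, (∀ n, (P n).Nonempty) →
        ∃ X : ChannelCRNG.GeneralSource 𝒳, (∀ n, X n ∈ P n) ∧
          ∀ X' : ChannelCRNG.GeneralSource 𝒳, (∀ n, X' n ∈ P n) →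
            ChannelCRNG.entropyGap X' W ≤ ChannelCRNG.entropyGap X W) ∧
    -- without input constraint the maximum is the operational capacity
    (∀ X : ChannelCRNG.GeneralSource 𝒳,
        (∀ X' : ChannelCRNG.GeneralSource 𝒳,
            ChannelCRNG.entropyGap X' W ≤ ChannelCRNG.entropyGap X W) →
        ChannelCRNG.channelCapacity W (ChannelCRNG.noConstraint 𝒳) =
          (ChannelCRNG.entropyGap X W : EReal)) ∧
    -- the capacity is achieved by the code built from any maximizing source
    (∀ (P : ChannelCRNG.InputConstraint 𝒳) (X : ChannelCRNG.GeneralSource 𝒳),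
        (∀ n, X n ∈ P n) →
        (∀ X' : ChannelCRNG.GeneralSource 𝒳, (∀ n, X' n ∈ P n) →
            ChannelCRNG.entropyGap X' W ≤ ChannelCRNG.entropyGap X W) →
        0 < ChannelCRNG.entropyGap X W →
        ∀ ε : ℝ, 0 < ε →
          ∃ (𝒜 ℬ : (n : ℕ) → ChannelCRNG.FunctionEnsemble (Fin n → 𝒳) ℕ)
            (αA βA αB βB : ℕ → ℝ) (r R : ℝ),
            ChannelCRNG.CollisionResistance 𝒜 αA βA ∧
            ChannelCRNG.BalancedColoring ℬ αB βB ∧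
            Tendsto (fun n => ChannelCRNG.ensembleRate n (𝒜 n)) atTop (𝓝 r) ∧
            Tendsto (fun n => ChannelCRNG.ensembleRate n (ℬ n)) atTop (𝓝 R) ∧
            ChannelCRNG.condSupEntropyRate X W < r ∧
            r + R < ChannelCRNG.infEntropyRate X ∧
            ChannelCRNG.entropyGap X W - ε < R ∧
            ∀ dec : (n : ℕ) → ((Fin n → 𝒳) → ℕ) → ℕ → (Fin n → 𝒴) → (Fin n → 𝒳),
            (∀ n, ∀ A ∈ (𝒜 n).carrier, ChannelCRNG.IsMAPDecoder X W n A (dec n A)) →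
            ∀ δ : ℝ, 0 < δ → ∀ᶠ n : ℕ in atTop,
              ChannelCRNG.channelCapacity W P <
                ((ChannelCRNG.ensembleRate n (ℬ n) + ε : ℝ) : EReal) ∧
              ∃ A ∈ (𝒜 n).carrier, ∃ B ∈ (ℬ n).carrier, ∃ c ∈ (𝒜 n).im,
                ChannelCRNG.codeError (X n) (W n) (ℬ n).im A B c (dec n A) < δ) := by
  refine ⟨?_, fun P hP => ChannelCRNG.exists_maximal_entropyGap W hP, ?_, ?_⟩
  · intro X K L 𝒜 ℬ αA βA αB βB r R hA hB hr hR h1 h2 dec hdec δ hδ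
    exact ChannelCRNG.eventually_exists_codeError_lt hA hB hr hR h1 h2 dec hdec hδ
  · intro X hmax
    exact le_antisymm
      (ChannelCRNG.channelCapacity_le (fun n => ⟨X n, Set.mem_univ _⟩) fun X' _ => hmax X')
      (ChannelCRNG.entropyGap_le_channelCapacity X)
  · intro P X hX hmax hpos ε hε
    obtain ⟨𝒜, ℬ, αA, βA, αB, βB, r, R, hA, hB, hr, hR, h1, h2, h3⟩ :=
      ChannelCRNG.exists_ensembles hpos hε
    refine ⟨𝒜, ℬ, αA, βA, αB, βB, r, R, hA, hB, hr, hR, h1, h2, h3, ?_⟩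
    intro dec hdec δ hδ
    filter_upwards [hR.eventually_const_lt h3,
      ChannelCRNG.eventually_exists_codeError_lt hA hB hr hR h1 h2 dec hdec hδ] with n hn herr
    -- Only the converse is used here, and it holds under every input constraint.
    refine ⟨(ChannelCRNG.channelCapacity_le (fun n => ⟨X n, hX n⟩) hmax).trans_lt ?_, herr⟩
    exact EReal.coe_lt_coe_iff.2 (by linarith)
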